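/- Let $K$ be $\mathbb{Q}$ or an imaginary quadratic number field, regarded as a subfield of $\mathbb{C}$, with ring of integers $\mathcal{O}_K$, discriminant $D_K$ and Dedekind zeta function $\zeta_K$. Two elements $\alpha,\beta\in K$ are called Farey neighbours if there are $p,q,r,s\in\mathcal{O}_K$ with $q,s\neq 0$, $\alpha=\frac{p}{q}$, $\beta=\frac{r}{s}$ and $|ps-qr|=1$ (equivalently $ps-qr\in\mathcal{O}_K^\times$). Let $\mathfrak{N}_K$ be the set of unordered pairs of Farey neighbours in $K$, on which the additive group $\mathcal{O}_K$ acts by simultaneous translations $t+\{\alpha,\beta\}=\{\alpha+t,\beta+t\}$. **Theorem 1.** (1) For every $\epsilon>0$ the set $\{\{\alpha,\beta\}\in\mathfrak{N}_{\mathbb{Q}} : \alpha,\beta\in[0,1],\ |\beta-\alpha|\geq\epsilon\}$ is finite, and as $\epsilon>0$ tends to $0$, $$\operatorname{Card}\{\{\alpha,\beta\}\in\mathfrak{N}_{\mathbb{Q}} : \alpha,\beta\in[0,1],\ |\beta-\alpha|\geq\epsilon\}=-\frac{6}{\pi^2}\,\frac{\ln\epsilon}{\epsilon}+O(\epsilon^{-1}).$$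 (2) Let $K$ be an imaginary quadratic number field. For every $\epsilon>0$ the set of $\mathcal{O}_K$-orbits $\mathcal{O}_K\backslash\{\{\alpha,\beta\}\in\mathfrak{N}_K : |\beta-\alpha|\geq\epsilon\}$ is finite, and as $\epsilon>0$ tends to $0$, $$\operatorname{Card}\bigl(\mathcal{O}_K\backslash\{\{\alpha,\beta\}\in\mathfrak{N}_K : |\beta-\alpha|\geq\epsilon\}\bigr)=\frac{4\pi^2}{|\mathcal{O}_K^\times|\,D_K\,\zeta_K(2)}\,\frac{\ln\epsilon}{\epsilon^2}+O(\epsilon^{-2}),$$ where the constant implied by $O(\cdot)$ may depend on $K$. -/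

import Mathlib

open NumberField Filter Topology Asymptotics

/-- Two elements `α`, `β` of a number field `K` are Farey neighbours if they can be written
`α = p / q`, `β = r / s` with `p, q, r, s` integers of `K` (and `q, s ≠ 0`) such that
`p * s - q * r` is a unit of the ring of integers. When `K` is `ℚ` or imaginary quadratic, the
last condition means `|p * s - q * r| = 1`. -/
def AreFareyNeighbours (K : Type*) [Field K] (α β : K) : Prop :=
  ∃ p q r s : 𝓞 K, q ≠ 0 ∧ s ≠ 0 ∧ α = (p : K) / (q : K) ∧ β = (r : K) / (s : K) ∧
    IsUnit (p * s - q * r)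

/-- The set of unordered pairs of Farey neighbours in `K`. -/
def fareyPairs (K : Type*) [Field K] : Set (Sym2 K) :=
  {z | ∃ α β : K, z = s(α, β) ∧ AreFareyNeighbours K α β}

/-- The orbit equivalence relation on unordered pairs of elements of `K` for the action of the
additive group of integers of `K` by simultaneous translations
`t + {α, β} = {α + t, β + t}`. -/
def translationSetoid (K : Type*) [Field K] : Setoid (Sym2 K) where
  r z w := ∃ t : 𝓞 K, w = z.map (fun x => x + (t : K))
  iseqv :=
    { refl := fun z => ⟨0, by simp⟩
      symm := by
        rintro z w ⟨t, rfl⟩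
        exact ⟨-t, by simp [Sym2.map_map]⟩
      trans := by
        rintro z w v ⟨t, rfl⟩ ⟨u, rfl⟩
        exact ⟨t + u, by simp [Sym2.map_map, add_assoc]⟩ }

/-- The unordered pairs `{α, β}` of rational Farey neighbours in `[0, 1]` with
`|β - α| ≥ ε`. -/
def rationalFareyPairs (ε : ℝ) : Set (Sym2 ℚ) :=
  {z | z ∈ fareyPairs ℚ ∧ ∃ α β : ℚ, z = s(α, β) ∧ α ∈ Set.Icc (0 : ℚ) 1 ∧
    β ∈ Set.Icc (0 : ℚ) 1 ∧ ε ≤ |(β : ℝ) - (α : ℝ)|}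

/-- The unordered pairs `{α, β}` of Farey neighbours in `K` with `|β - α| ≥ ε`, where `K` is
regarded as a subfield of `ℂ` through `φ`. -/
def longFareyPairs {K : Type*} [Field K] (φ : K →+* ℂ) (ε : ℝ) : Set (Sym2 K) :=
  {z | z ∈ fareyPairs K ∧ ∃ α β : K, z = s(α, β) ∧ ε ≤ ‖φ β - φ α‖}

/-- The set of classes, modulo simultaneous translations by integers of `K`, of the pairs in
`longFareyPairs φ ε`. -/
def longFareyClasses {K : Type*} [Field K] (φ : K →+* ℂ) (ε : ℝ) :
    Set (Quotient (translationSetoid K)) :=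
  Quotient.mk (translationSetoid K) '' longFareyPairs φ ε

/-! A Farey pair is governed by its denominators. If `p * s - q * r = 1`, then `|β - α| = 1 / |q
s|`, and for given coprime `q`, `s` any two solutions `(p, r)` differ by a multiple `t (q, s)`, that
is, by translation by `t`. Hence translation classes come from coprime pairs `(q, s)`. Over an
imaginary quadratic `K` the pairs with the same class are exactly `(u q, u⁻¹ s)` and `(u s, -u⁻¹ q)`
with `u` a unit, so the wanted count is the number of coprime pairs with `N(q) N(s) ≤ X = ε⁻²`,
divided by `2 |𝓞ˣ|`. Over `ℚ`, ordering `α < β` in `[0, 1]` and taking positive denominators gives a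
bijection with coprime pairs of positive integers satisfying `q s ≤ X = 1 / ε`.

Coprimality is removed by inclusion-exclusion over squarefree ideals `J`, encoded as finite sets of
primes. Pairs in `J` with `N(q) N(s) ≤ X` are counted in the scale of `J`, with `Y = X / N(J)²`. The
points `x` of `J` with `N(x) ≤ t N(J)` number `κ t + O(√t)`, `κ = 2π / √|D|`, by lattice point
counting; the error is uniform in `J` because multiplying by elements of `𝓞` leaves only finitely
many ideal classes to treat. Over `ℚ`, `κ = 1`. Summing over one coordinate gives `κ² Y log Y +
O(Y)` pairs.

Adding up over `J`, the main constant is `κ² ∑ μ(J) / N(J)² = κ² / ζ_K(2)`. Replacing `log (X /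
N(J)²)` by `log X` costs `log N(J)`, absorbed by the convergent sum of `N(J)^(-3/2)`. Finally `log X
= -2 log ε` (or `-log ε` over `ℚ`) and `D < 0` give the stated coefficients. -/

/-! ### Abel summation, hyperbola sums and superposition of dilations -/

open MeasureTheory in
/-- Abel summation of `k ^ (-s)` against coefficients whose summatory function is
`κ t + O(√t)`. -/
lemma abs_sum_rpow_mul_sub_le {c : ℕ → ℝ} (hc : c 0 = 0) {κ C : ℝ}
    (h : ∀ t : ℝ, 1 ≤ t → |∑ k ∈ Finset.Icc 0 ⌊t⌋₊, c k - κ * t| ≤ C * t ^ (1 / 2 : ℝ))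
    {s : ℝ} (hs : 0 < s) {Y : ℝ} (hY : 1 ≤ Y) :
    |∑ k ∈ Finset.Icc 0 ⌊Y⌋₊, (k : ℝ) ^ (-s) * c k
        - (Y ^ (-s) * ∑ k ∈ Finset.Icc 0 ⌊Y⌋₊, c k + κ * s * ∫ t in (1 : ℝ)..Y, t ^ (-s))|
      ≤ C * s * ∫ t in (1 : ℝ)..Y, t ^ (-s - 1 / 2) := by
  have hpos : ∀ t ∈ Set.Icc 1 Y, 0 < t := fun t ht => lt_of_lt_of_le one_pos ht.1
  have hcont : ∀ r : ℝ, ContinuousOn (fun t : ℝ => t ^ r) (Set.Icc 1 Y) := fun r =>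
    continuousOn_id.rpow_const fun t ht => Or.inl (hpos t ht).ne'
  have hint : ∀ r : ℝ, IntervalIntegrable (fun t : ℝ => t ^ r) volume 1 Y := fun r =>
    ContinuousOn.intervalIntegrable (by rw [Set.uIcc_of_le hY]; exact hcont r)
  have hderiv : ∀ t ∈ Set.Icc 1 Y,
      deriv (fun t : ℝ => t ^ (-s)) t = -s * t ^ (-s - 1) := fun t ht =>
    Real.deriv_rpow_const t (-s)
  have hdint : IntegrableOn (deriv fun t : ℝ => t ^ (-s)) (Set.Icc 1 Y) := by
    refine IntegrableOn.congr_fun (f := fun t => -s * t ^ (-s - 1)) ?_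
      (fun t ht => (hderiv t ht).symm) measurableSet_Icc
    exact (continuousOn_const.mul (hcont _)).integrableOn_Icc
  have key := sum_mul_eq_sub_integral_mul₀ (f := fun t : ℝ => t ^ (-s)) c hc Y
    (fun t ht => Real.differentiableAt_rpow_const_of_ne _ (hpos t ht).ne') hdint
  have hprod : IntervalIntegrable
      (fun t => deriv (fun t : ℝ => t ^ (-s)) t * ∑ k ∈ Finset.Icc 0 ⌊t⌋₊, c k) volume 1 Y := by
    rw [intervalIntegrable_iff_integrableOn_Icc_of_le hY]
    exact integrableOn_mul_sum_Icc c zero_le_one hdint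
  rw [← intervalIntegral.integral_of_le hY] at key
  -- What remains is Abel's integral with the summatory function replaced by its error `A(t) - κ t`.
  have hdiff : ∑ k ∈ Finset.Icc 0 ⌊Y⌋₊, (k : ℝ) ^ (-s) * c k
        - (Y ^ (-s) * ∑ k ∈ Finset.Icc 0 ⌊Y⌋₊, c k + κ * s * ∫ t in (1 : ℝ)..Y, t ^ (-s))
      = -∫ t in (1 : ℝ)..Y, (deriv (fun t : ℝ => t ^ (-s)) t * ∑ k ∈ Finset.Icc 0 ⌊t⌋₊, c k
          + κ * s * t ^ (-s)) := by
    rw [intervalIntegral.integral_add hprod ((hint _).const_mul _),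
      intervalIntegral.integral_const_mul, key]
    ring
  rw [hdiff, abs_neg, ← intervalIntegral.integral_const_mul, ← Real.norm_eq_abs]
  refine intervalIntegral.norm_integral_le_of_norm_le hY ?_ ((hint _).const_mul _)
  refine Eventually.of_forall fun t ht => ?_
  have ht' : t ∈ Set.Icc 1 Y := ⟨ht.1.le, ht.2⟩
  have h0 := hpos t ht'
  rw [hderiv t ht']
  have e1 : t ^ (-s) = t ^ (-s - 1) * t := by
    rw [← Real.rpow_add_one h0.ne']; congr 1; ring
  have e2 : t ^ (-s - 1 / 2) = t ^ (-s - 1) * t ^ (1 / 2 : ℝ) := by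
    rw [← Real.rpow_add h0]; congr 1; ring
  have e3 : -s * t ^ (-s - 1) * ∑ k ∈ Finset.Icc 0 ⌊t⌋₊, c k + κ * s * t ^ (-s)
      = -(s * t ^ (-s - 1)) * (∑ k ∈ Finset.Icc 0 ⌊t⌋₊, c k - κ * t) := by
    rw [e1]; ring
  rw [e3, e2, Real.norm_eq_abs, abs_mul, abs_neg, abs_of_pos (by positivity)]
  calc _ ≤ s * t ^ (-s - 1) * (C * t ^ (1 / 2 : ℝ)) := by gcongr; exact h t ht'.1
    _ = _ := by ring

/-- Logarithmic sums of coefficients with summatory function `κ t + O(√t)`. -/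
lemma abs_sum_div_sub_log_le {c : ℕ → ℝ} (hc : c 0 = 0) {κ C : ℝ}
    (h : ∀ t : ℝ, 1 ≤ t → |∑ k ∈ Finset.Icc 0 ⌊t⌋₊, c k - κ * t| ≤ C * t ^ (1 / 2 : ℝ))
    {Y : ℝ} (hY : 1 ≤ Y) :
    |∑ k ∈ Finset.Icc 0 ⌊Y⌋₊, c k / k - κ * Real.log Y| ≤ |κ| + 3 * C := by
  have hY0 : 0 < Y := by linarith
  have hC : 0 ≤ C := by simpa using (abs_nonneg _).trans (h 1 le_rfl)
  have h1 := abs_sum_rpow_mul_sub_le hc h one_pos hY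
  have i1 : ∫ t in (1 : ℝ)..Y, t ^ (-1 : ℝ) = Real.log Y := by
    simp_rw [Real.rpow_neg_one]
    rw [integral_inv_of_pos one_pos hY0, div_one]
  have i2 : ∫ t in (1 : ℝ)..Y, t ^ (-1 - 1 / 2 : ℝ) = 2 - 2 * Y ^ (-(1 / 2) : ℝ) := by
    rw [integral_rpow (Or.inr ⟨by norm_num, Set.notMem_uIcc_of_lt one_pos hY0⟩)]
    norm_num
    ring
  rw [i1, i2] at h1
  have h2 : |Y ^ (-1 : ℝ) * ∑ k ∈ Finset.Icc 0 ⌊Y⌋₊, c k| ≤ |κ| + C := by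
    have e : Y ^ (1 / 2 : ℝ) ≤ Y := by
      conv_rhs => rw [← Real.rpow_one Y]
      exact Real.rpow_le_rpow_of_exponent_le hY (by norm_num)
    have : |∑ k ∈ Finset.Icc 0 ⌊Y⌋₊, c k| ≤ (|κ| + C) * Y := by
      calc |∑ k ∈ Finset.Icc 0 ⌊Y⌋₊, c k|
          = |(∑ k ∈ Finset.Icc 0 ⌊Y⌋₊, c k - κ * Y) + κ * Y| := by rw [sub_add_cancel]
        _ ≤ C * Y ^ (1 / 2 : ℝ) + |κ| * Y := by
            refine (abs_add_le _ _).trans (add_le_add (h Y hY) ?_)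
            rw [abs_mul, abs_of_pos hY0]
        _ ≤ C * Y + |κ| * Y := by gcongr
        _ = _ := by ring
    rw [Real.rpow_neg_one, abs_mul, abs_of_pos (inv_pos.2 hY0), inv_mul_le_iff₀ hY0]
    linarith
  have e0 : ∑ k ∈ Finset.Icc 0 ⌊Y⌋₊, (k : ℝ) ^ (-1 : ℝ) * c k
      = ∑ k ∈ Finset.Icc 0 ⌊Y⌋₊, c k / k :=
    Finset.sum_congr rfl fun k _ => by rw [Real.rpow_neg_one, div_eq_inv_mul]
  rw [e0] at h1
  have h3 : C * 1 * (2 - 2 * Y ^ (-(1 / 2) : ℝ)) ≤ 2 * C := by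
    have := Real.rpow_nonneg hY0.le (-(1 / 2) : ℝ)
    nlinarith
  rw [abs_le] at *
  constructor <;> linarith [h1.1, h1.2, h2.1, h2.2]

/-- Controls the total of the errors `√(Y / k)` in the hyperbola sum. Abel summation at exponent `1
/ 2` leaves a logarithm in the error, absorbed by `log Y ≤ 2 √Y`. -/
lemma sum_rpow_neg_half_le {c : ℕ → ℝ} (hc : c 0 = 0) {κ C : ℝ}
    (h : ∀ t : ℝ, 1 ≤ t → |∑ k ∈ Finset.Icc 0 ⌊t⌋₊, c k - κ * t| ≤ C * t ^ (1 / 2 : ℝ))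
    {Y : ℝ} (hY : 1 ≤ Y) :
    ∑ k ∈ Finset.Icc 0 ⌊Y⌋₊, (k : ℝ) ^ (-(1 / 2) : ℝ) * c k
      ≤ 2 * (|κ| + C) * Y ^ (1 / 2 : ℝ) := by
  have hY0 : 0 < Y := by linarith
  have hC : 0 ≤ C := by simpa using (abs_nonneg _).trans (h 1 le_rfl)
  have h1 := abs_sum_rpow_mul_sub_le hc h (s := 1 / 2) (by norm_num) hY
  have i1 : ∫ t in (1 : ℝ)..Y, t ^ (-(1 / 2) : ℝ) = 2 * Y ^ (1 / 2 : ℝ) - 2 := by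
    rw [integral_rpow (Or.inl (by norm_num))]
    norm_num
    ring
  have i2 : ∫ t in (1 : ℝ)..Y, t ^ (-(1 / 2) - 1 / 2 : ℝ) = Real.log Y := by
    have : (-(1 / 2) - 1 / 2 : ℝ) = -1 := by norm_num
    simp_rw [this, Real.rpow_neg_one]
    rw [integral_inv_of_pos one_pos hY0, div_one]
  rw [i1, i2] at h1
  have hlog : Real.log Y ≤ 2 * Y ^ (1 / 2 : ℝ) := by
    have := Real.log_le_rpow_div hY0.le (ε := 1 / 2) (by norm_num)
    linarith
  have hone : 1 ≤ Y ^ (1 / 2 : ℝ) := Real.one_le_rpow hY (by norm_num)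
  have hsq : Y ^ (-(1 / 2) : ℝ) * Y = Y ^ (1 / 2 : ℝ) := by
    rw [← Real.rpow_add_one hY0.ne']; norm_num
  have hsq2 : Y ^ (-(1 / 2) : ℝ) * Y ^ (1 / 2 : ℝ) = 1 := by
    rw [← Real.rpow_add hY0]; norm_num
  have h2 : Y ^ (-(1 / 2) : ℝ) * ∑ k ∈ Finset.Icc 0 ⌊Y⌋₊, c k ≤ κ * Y ^ (1 / 2 : ℝ) + C := by
    calc _ ≤ Y ^ (-(1 / 2) : ℝ) * (κ * Y + C * Y ^ (1 / 2 : ℝ)) := by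
          gcongr; linarith [(abs_le.1 (h Y hY)).2]
      _ = κ * (Y ^ (-(1 / 2) : ℝ) * Y) + C * (Y ^ (-(1 / 2) : ℝ) * Y ^ (1 / 2 : ℝ)) := by ring
      _ = _ := by rw [hsq, hsq2, mul_one]
  have h3 := (abs_le.1 h1).2
  have hk := neg_abs_le κ
  have hk2 := le_abs_self κ
  nlinarith

/-- The hyperbola method for two copies of a sequence with summatory function `κ t + O(√t)`. -/
lemma exists_abs_hyperbola_sum_sub_le (κ C : ℝ) :
    ∃ B : ℝ, ∀ c : ℕ → ℝ, c 0 = 0 → (∀ k, 0 ≤ c k) →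
      (∀ t : ℝ, 1 ≤ t → |∑ k ∈ Finset.Icc 0 ⌊t⌋₊, c k - κ * t| ≤ C * t ^ (1 / 2 : ℝ)) →
      ∀ Y : ℝ, 1 ≤ Y →
        |∑ k ∈ Finset.Icc 0 ⌊Y⌋₊, c k * ∑ l ∈ Finset.Icc 0 ⌊Y / k⌋₊, c l
          - κ ^ 2 * (Y * Real.log Y)| ≤ B * Y := by
  -- The two terms come from the logarithmic sum and from the accumulated inner errors. Since those
  -- errors are only `√(Y / k)`, they sum to `O(Y)` over all `k ≤ Y`, and no splitting at `√Y` is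
  -- needed. The constant depends on `κ` and `C` alone, which gives uniformity in the ideal later.
  refine ⟨|κ| * (|κ| + 3 * C) + C * (2 * (|κ| + C)), fun c hc hc0 h Y hY => ?_⟩
  have hY0 : 0 < Y := by linarith
  have hC : 0 ≤ C := by simpa using (abs_nonneg _).trans (h 1 le_rfl)
  have h1 := abs_sum_div_sub_log_le hc h hY
  have h2 := sum_rpow_neg_half_le hc h hY
  have h3 : |∑ k ∈ Finset.Icc 0 ⌊Y⌋₊, c k * ∑ l ∈ Finset.Icc 0 ⌊Y / k⌋₊, c l
      - κ * Y * ∑ k ∈ Finset.Icc 0 ⌊Y⌋₊, c k / k|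
      ≤ C * Y ^ (1 / 2 : ℝ) * ∑ k ∈ Finset.Icc 0 ⌊Y⌋₊, (k : ℝ) ^ (-(1 / 2) : ℝ) * c k := by
    rw [Finset.mul_sum, Finset.mul_sum, ← Finset.sum_sub_distrib]
    refine (Finset.abs_sum_le_sum_abs _ _).trans (Finset.sum_le_sum fun k hk => ?_)
    rcases Nat.eq_zero_or_pos k with rfl | hk0
    · simp [hc]
    have hk0' : (0 : ℝ) < k := by exact_mod_cast hk0
    have hkY : (k : ℝ) ≤ Y := (Nat.le_floor_iff hY0.le).1 (Finset.mem_Icc.1 hk).2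
    have e := h (Y / k) ((one_le_div hk0').2 hkY)
    have e1 : c k * ∑ l ∈ Finset.Icc 0 ⌊Y / k⌋₊, c l - κ * Y * (c k / k)
        = c k * (∑ l ∈ Finset.Icc 0 ⌊Y / k⌋₊, c l - κ * (Y / k)) := by
      field_simp
    rw [e1, abs_mul, abs_of_nonneg (hc0 k)]
    calc _ ≤ c k * (C * (Y / k) ^ (1 / 2 : ℝ)) := mul_le_mul_of_nonneg_left e (hc0 k)
      _ = _ := by
        rw [Real.div_rpow hY0.le hk0'.le, Real.rpow_neg hk0'.le]
        ring
  have h4 : C * Y ^ (1 / 2 : ℝ) * ∑ k ∈ Finset.Icc 0 ⌊Y⌋₊, (k : ℝ) ^ (-(1 / 2) : ℝ) * c k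
      ≤ C * (2 * (|κ| + C)) * Y := by
    have hsq : Y ^ (1 / 2 : ℝ) * Y ^ (1 / 2 : ℝ) = Y := by
      rw [← Real.rpow_add hY0]; norm_num
    calc _ ≤ C * Y ^ (1 / 2 : ℝ) * (2 * (|κ| + C) * Y ^ (1 / 2 : ℝ)) := by gcongr
      _ = C * (2 * (|κ| + C)) * (Y ^ (1 / 2 : ℝ) * Y ^ (1 / 2 : ℝ)) := by ring
      _ = _ := by rw [hsq]
  have h5 : |κ * Y * ∑ k ∈ Finset.Icc 0 ⌊Y⌋₊, c k / k - κ ^ 2 * (Y * Real.log Y)|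
      ≤ |κ| * (|κ| + 3 * C) * Y := by
    have : κ * Y * ∑ k ∈ Finset.Icc 0 ⌊Y⌋₊, c k / k - κ ^ 2 * (Y * Real.log Y)
        = κ * Y * (∑ k ∈ Finset.Icc 0 ⌊Y⌋₊, c k / k - κ * Real.log Y) := by ring
    rw [this, abs_mul, abs_mul, abs_of_pos hY0]
    calc _ ≤ |κ| * Y * (|κ| + 3 * C) := by gcongr
      _ = _ := by ring
  have := abs_sub_le (∑ k ∈ Finset.Icc 0 ⌊Y⌋₊, c k * ∑ l ∈ Finset.Icc 0 ⌊Y / k⌋₊, c l)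
    (κ * Y * ∑ k ∈ Finset.Icc 0 ⌊Y⌋₊, c k / k) (κ ^ 2 * (Y * Real.log Y))
  linarith

/-- Superposition of functions `F j (X / n j ^ 2)` where every `F j Y` is
`a Y log Y + O(Y)`, uniformly in `j`. -/
lemma exists_abs_sub_le_of_hasSum_dilations {J : Type*} {n m : J → ℝ} (hn : ∀ j, 1 ≤ n j)
    (hm : ∀ j, |m j| ≤ 1) (hs : Summable fun j => n j ^ (-(3 / 2) : ℝ))
    {F : J → ℝ → ℝ} {a B : ℝ} (ha : 0 ≤ a) (hF0 : ∀ j Y, Y < 1 → F j Y = 0)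
    (hF : ∀ j Y, 1 ≤ Y → |F j Y - a * (Y * Real.log Y)| ≤ B * Y)
    {P : ℝ → ℝ} (hP : ∀ X, 1 ≤ X → HasSum (fun j => m j * F j (X / n j ^ 2)) (P X)) :
    ∃ D : ℝ, ∀ X, 1 ≤ X →
      |P X - a * (∑' j, m j / n j ^ 2) * (X * Real.log X)| ≤ D * X := by
  have hn0 : ∀ j, 0 < n j := fun j => one_pos.trans_le (hn j)
  have hsq : ∀ j, (n j ^ 2)⁻¹ ≤ n j ^ (-(3 / 2) : ℝ) := fun j => by
    rw [← Real.rpow_natCast, ← Real.rpow_neg (hn0 j).le]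
    exact Real.rpow_le_rpow_of_exponent_le (hn j) (by norm_num)
  have hsm : Summable fun j => m j / n j ^ 2 := by
    refine Summable.of_norm_bounded hs fun j => ?_
    rw [Real.norm_eq_abs, abs_div, abs_of_pos (pow_pos (hn0 j) 2), div_eq_mul_inv]
    calc _ ≤ 1 * (n j ^ 2)⁻¹ := by
          gcongr
          exact hm j
      _ ≤ _ := by rw [one_mul]; exact hsq j
  -- The `4 * a` bounds the loss `2 a log n` from replacing `log (X / n²)` by `log X`, using `log n
  -- ≤ 2 √n`.
  refine ⟨(|B| + 4 * a) * ∑' j, n j ^ (-(3 / 2) : ℝ), fun X hX => ?_⟩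
  have hX0 : 0 < X := by linarith
  have hlogX := Real.log_nonneg hX
  have h1 := (hP X hX).sub (hsm.hasSum.mul_left (a * (X * Real.log X)))
  have h2 : ∀ j, ‖m j * F j (X / n j ^ 2) - a * (X * Real.log X) * (m j / n j ^ 2)‖
      ≤ (|B| + 4 * a) * X * n j ^ (-(3 / 2) : ℝ) := fun j => by
    have hnj := hn0 j
    have hlogn := Real.log_nonneg (hn j)
    have hY0 : 0 < X / n j ^ 2 := by positivity
    have e1 : m j * F j (X / n j ^ 2) - a * (X * Real.log X) * (m j / n j ^ 2)
        = m j * (F j (X / n j ^ 2) - a * (X / n j ^ 2 * Real.log X)) := by ring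
    have hlog : Real.log (X / n j ^ 2) = Real.log X - 2 * Real.log (n j) := by
      rw [Real.log_div hX0.ne' (by positivity), Real.log_pow]; norm_num
    have e2 : |F j (X / n j ^ 2) - a * (X / n j ^ 2 * Real.log X)|
        ≤ (|B| + 2 * a * Real.log (n j)) * (X / n j ^ 2) := by
      -- When `X < n²` the function vanishes but the main term does not; then `log X < 2 log n`, so
      -- it obeys the same bound.
      rcases lt_or_ge (X / n j ^ 2) 1 with hlt | hge
      · have h0 := Real.log_neg hY0 hlt
        rw [hF0 j _ hlt, zero_sub, abs_neg, abs_of_nonneg (by positivity)]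
        have : a * (X / n j ^ 2) * Real.log X ≤ a * (X / n j ^ 2) * (2 * Real.log (n j)) := by
          gcongr; linarith
        have hB : 0 ≤ |B| * (X / n j ^ 2) := by positivity
        linarith
      · have h0 := hF j _ hge
        have h3 : B * (X / n j ^ 2) ≤ |B| * (X / n j ^ 2) := by gcongr; exact le_abs_self B
        have h4 : F j (X / n j ^ 2) - a * (X / n j ^ 2 * Real.log X)
            = (F j (X / n j ^ 2) - a * (X / n j ^ 2 * Real.log (X / n j ^ 2)))
              + -(2 * a * Real.log (n j) * (X / n j ^ 2)) := by rw [hlog]; ring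
        rw [h4]
        refine (abs_add_le _ _).trans ?_
        rw [abs_neg, abs_of_nonneg (a := 2 * a * Real.log (n j) * (X / n j ^ 2)) (by positivity)]
        linarith
    have e3 : Real.log (n j) ≤ 2 * n j ^ (1 / 2 : ℝ) := by
      have := Real.log_le_rpow_div hnj.le (ε := 1 / 2) (by norm_num)
      linarith
    have e4 : n j ^ (-(3 / 2) : ℝ) = n j ^ (1 / 2 : ℝ) / n j ^ 2 := by
      rw [← Real.rpow_natCast, ← Real.rpow_sub hnj]; norm_num
    have e5 : 1 ≤ n j ^ (1 / 2 : ℝ) := Real.one_le_rpow (hn j) (by norm_num)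
    rw [e1, Real.norm_eq_abs, abs_mul]
    calc _ ≤ 1 * ((|B| + 2 * a * Real.log (n j)) * (X / n j ^ 2)) := by
          gcongr
          exact hm j
      _ ≤ (|B| * n j ^ (1 / 2 : ℝ) + 2 * a * (2 * n j ^ (1 / 2 : ℝ))) * (X / n j ^ 2) := by
          rw [one_mul]
          gcongr
          exact le_mul_of_one_le_right (abs_nonneg B) e5
      _ = _ := by rw [e4]; ring
  have h3 := tsum_of_norm_bounded (hs.hasSum.mul_left ((|B| + 4 * a) * X)) h2
  rw [h1.tsum_eq, Real.norm_eq_abs] at h3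
  calc _ = |P X - a * (X * Real.log X) * ∑' j, m j / n j ^ 2| := by ring_nf
    _ ≤ _ := h3
    _ = _ := by ring

/-! ### Lattice points in balls -/

open MeasureTheory Pointwise in
/-- Translates of a bounded fundamental domain by the lattice points of a ball are sandwiched
between two balls. -/
lemma ZLattice.exists_measureReal_ball_le_ncard_mul_covolume_le {E : Type*}
    [NormedAddCommGroup E] [NormedSpace ℝ E] [FiniteDimensional ℝ E] [MeasurableSpace E]
    [BorelSpace E] (L : Submodule ℤ E) [DiscreteTopology L] [IsZLattice ℝ L]
    (μ : Measure E) [μ.IsAddHaarMeasure] :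
    ∃ D : ℝ, 0 < D ∧ ∀ R : ℝ, ((L : Set E) ∩ Metric.closedBall 0 R).Finite ∧
      μ.real (Metric.ball 0 (R - D)) ≤
        ((L : Set E) ∩ Metric.closedBall 0 R).ncard * ZLattice.covolume L μ ∧
      ((L : Set E) ∩ Metric.closedBall 0 R).ncard * ZLattice.covolume L μ ≤
        μ.real (Metric.ball 0 (R + D)) := by
  classical
  set b := (Module.Free.chooseBasis ℤ L).ofZLatticeBasis ℝ L with hb
  set F := ZSpan.fundamentalDomain b with hFdef
  have hspan : Submodule.span ℤ (Set.range b) = L :=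
    (Module.Free.chooseBasis ℤ L).ofZLatticeBasis_span ℝ
  have hF : IsAddFundamentalDomain L F μ :=
    ZLattice.isAddFundamentalDomain (Module.Free.chooseBasis ℤ L) μ
  have hFm : MeasurableSet F := ZSpan.fundamentalDomain_measurableSet b
  have hFb : Bornology.IsBounded F := ZSpan.fundamentalDomain_isBounded b
  obtain ⟨D, hD0, hD⟩ := hFb.exists_pos_norm_lt
  refine ⟨D, hD0, fun R => ?_⟩
  set S : Set E := (L : Set E) ∩ Metric.closedBall 0 R with hS
  have hfin : S.Finite := by
    have := ZSpan.setFinite_inter b (Metric.isBounded_closedBall (x := (0 : E)) (r := R))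
    rw [hspan, Set.inter_comm] at this
    exact this
  have hcov : ZLattice.covolume L μ = μ.real F :=
    ZLattice.covolume_eq_measure_fundamentalDomain L μ hF
  set U : Set E := ⋃ x ∈ hfin.toFinset, (x +ᵥ F) with hU
  have hdisj : Set.PairwiseDisjoint (↑hfin.toFinset) fun x : E => x +ᵥ F := by
    intro x hx y hy hxy
    rw [Function.onFun, Set.disjoint_left]
    rintro z ⟨u, hu, rfl⟩ ⟨v, hv, hvz⟩
    have hxL : x ∈ L := ((Set.Finite.mem_toFinset _).1 hx).1
    have hyL : y ∈ L := ((Set.Finite.mem_toFinset _).1 hy).1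
    simp only [vadd_eq_add] at hvz
    have h1 : ZSpan.fract b u = ZSpan.fract b v := by
      rw [ZSpan.fract_eq_fract, hspan]
      have : -u + v = x - y := by
        have : v = x + u - y := by rw [← hvz]; abel
        rw [this]; abel
      rw [this]
      exact sub_mem hxL hyL
    rw [ZSpan.fract_eq_self.2 hu, ZSpan.fract_eq_self.2 hv] at h1
    subst h1
    exact hxy (add_right_cancel hvz).symm
  have hUm : μ.real U = S.ncard * ZLattice.covolume L μ := by
    rw [hU, measureReal_biUnion_finset hdisj (fun x _ => hFm.const_vadd x)
      (fun x _ => by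
        rw [measure_vadd]; exact hFb.measure_lt_top.ne)]
    simp only [measureReal_def, measure_vadd, Finset.sum_const, nsmul_eq_mul]
    rw [hcov, measureReal_def, Set.ncard_eq_toFinset_card S hfin]
  refine ⟨hfin, ?_, ?_⟩
  · rw [← hUm]
    refine measureReal_mono (fun z hz => ?_) (ne_top_of_le_ne_top
      (measure_ball_lt_top (μ := μ) (x := (0 : E)) (r := R + D)).ne (measure_mono ?_))
    · have hmem := ZSpan.fract_mem_fundamentalDomain b z
      have hfl : (ZSpan.floor b z : E) ∈ L := hspan.le (ZSpan.floor b z).2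
      refine Set.mem_biUnion (x := (ZSpan.floor b z : E)) ?_ ⟨ZSpan.fract b z, hmem, ?_⟩
      · rw [Finset.mem_coe, Set.Finite.mem_toFinset]
        refine ⟨hfl, ?_⟩
        rw [mem_closedBall_zero_iff]
        rw [mem_ball_zero_iff] at hz
        have e : (ZSpan.floor b z : E) = z - ZSpan.fract b z := by
          rw [ZSpan.fract_apply]; abel
        rw [e]
        linarith [norm_sub_le z (ZSpan.fract b z), hD _ hmem]
      · simp [ZSpan.fract_apply]
    · intro z hz
      obtain ⟨x, hx, u, hu, rfl⟩ := Set.mem_iUnion₂.1 hz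
      have := ((Set.Finite.mem_toFinset _).1 hx).2
      rw [mem_closedBall_zero_iff] at this
      rw [mem_ball_zero_iff]
      exact (norm_add_le _ _).trans_lt (add_lt_add_of_le_of_lt this (hD u hu))
  · rw [← hUm]
    refine measureReal_mono (fun z hz => ?_) measure_ball_lt_top.ne
    obtain ⟨x, hx, u, hu, rfl⟩ := Set.mem_iUnion₂.1 hz
    have := ((Set.Finite.mem_toFinset _).1 hx).2
    rw [mem_closedBall_zero_iff] at this
    rw [mem_ball_zero_iff]
    exact (norm_add_le _ _).trans_lt (add_lt_add_of_le_of_lt this (hD u hu))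

open MeasureTheory in
/-- In a plane, the number of lattice points in a ball of radius `R` is
`vol (ball 0 1) / covolume * R ^ 2 + O(R)`. -/
lemma ZLattice.exists_abs_ncard_inter_closedBall_sub_le {E : Type*}
    [NormedAddCommGroup E] [NormedSpace ℝ E] [FiniteDimensional ℝ E] [MeasurableSpace E]
    [BorelSpace E] (hE : Module.finrank ℝ E = 2) (L : Submodule ℤ E) [DiscreteTopology L]
    [IsZLattice ℝ L] (μ : Measure E) [μ.IsAddHaarMeasure] :
    ∃ C : ℝ, ∀ R : ℝ, 1 ≤ R →
      |(((L : Set E) ∩ Metric.closedBall 0 R).ncard : ℝ)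
        - μ.real (Metric.ball 0 1) / ZLattice.covolume L μ * R ^ 2| ≤ C * R := by
  obtain ⟨D, hD0, hD⟩ := ZLattice.exists_measureReal_ball_le_ncard_mul_covolume_le L μ
  set V := μ.real (Metric.ball (0 : E) 1) with hV
  have hV0 : 0 ≤ V := measureReal_nonneg
  have hcov := ZLattice.covolume_pos L μ
  have hball : ∀ r : ℝ, 0 ≤ r → μ.real (Metric.ball (0 : E) r) = r ^ 2 * V := fun r hr => by
    have : Nontrivial E := Module.nontrivial_of_finrank_pos (R := ℝ) (by omega)
    rw [measureReal_def, Measure.addHaar_ball μ _ hr, hE, ENNReal.toReal_mul,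
      ENNReal.toReal_ofReal (by positivity), ← measureReal_def]
  refine ⟨V * (2 * D + D ^ 2) / ZLattice.covolume L μ, fun R hR => ?_⟩
  obtain ⟨-, h1, h2⟩ := hD R
  set N : ℝ := (((L : Set E) ∩ Metric.closedBall 0 R).ncard : ℝ) with hN
  have hN0 : 0 ≤ N := Nat.cast_nonneg _
  have e1 : N - V / ZLattice.covolume L μ * R ^ 2
      = (N * ZLattice.covolume L μ - V * R ^ 2) / ZLattice.covolume L μ := by field_simp
  rw [e1, abs_div, abs_of_pos hcov, div_mul_eq_mul_div]
  gcongr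
  rw [hball _ (by linarith)] at h2
  have hDD : D ^ 2 ≤ D ^ 2 * R := le_mul_of_one_le_right (by positivity) hR
  have hlow : R ^ 2 * V - 2 * D * R * V ≤ N * ZLattice.covolume L μ := by
    -- If `R < D` the inner ball gives no information, but then `R² - 2 D R ≤ 0` and the lower bound
    -- is trivial.
    rcases le_or_gt D R with h | h
    · rw [hball _ (by linarith)] at h1
      nlinarith [mul_nonneg hV0 (sq_nonneg D)]
    · have : R ^ 2 * V - 2 * D * R * V ≤ 0 := by
        have : R * V * (R - 2 * D) ≤ 0 :=
          mul_nonpos_of_nonneg_of_nonpos (by positivity) (by linarith)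
        linarith
      exact this.trans (by positivity)
  rw [abs_le]
  constructor
  · nlinarith [mul_nonneg hV0 (sq_nonneg D), mul_nonneg (mul_nonneg hV0 (sq_nonneg D)) (by linarith : 0 ≤ R)]
  · nlinarith [mul_le_mul_of_nonneg_left hDD hV0]

/-! ### Sums over ideals and the Dedekind zeta function -/

section IdealSums

variable (K : Type*) [Field K] [NumberField K]

open Ideal

lemma sum_card_absNorm_eq_isBigO :
    (fun n : ℕ => ∑ k ∈ Finset.Icc 1 n, (Nat.card {I : Ideal (𝓞 K) // absNorm I = k} : ℝ))
      =O[atTop] fun n : ℕ => (n : ℝ) ^ (1 : ℝ) := by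
  have h1 := ((NumberField.Ideal.tendsto_norm_le_div_atTop₀ K).comp
    tendsto_natCast_atTop_atTop).isBigO_one ℝ
  have h2 := h1.mul (isBigO_refl (fun n : ℕ => (n : ℝ)) atTop)
  refine (h2.congr' ?_ ?_)
  · filter_upwards [eventually_gt_atTop 0] with n hn
    simp only [Function.comp_apply, Nat.cast_le]
    rw [div_mul_cancel₀ _ (by positivity), ← Nat.cast_sum]
    congr 1
    -- The limit concerns nonzero ideals; the added `1` is the zero ideal, the only one of norm `0`.
    rw [← add_left_inj 1, ← card_norm_le_eq_card_norm_le_add_one,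
      show Finset.Icc 1 n = Finset.Ioc 0 n from Finset.Icc_succ_left_eq_Ioc _ _,
      show 1 = Nat.card {I : Ideal (𝓞 K) // absNorm I = 0} by simp [Ideal.absNorm_eq_zero_iff],
      Finset.sum_Ioc_add_eq_sum_Icc (n.zero_le),
      ← Finset.card_preimage_eq_sum_card_image_eq (fun k _ ↦ finite_setOfPred_absNorm_eq k)]
    simp [Set.coe_eq_subtype]
  · exact Eventually.of_forall fun n => by simp

/-- Group ideals by norm and use that there are `O(n)` of norm at most `n`. Needed at `s = 2` for
the zeta value and at `s = 3 / 2` for the error terms. The zero ideal is harmless, as `0 ^ (-s) = 0`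
here. -/
lemma summable_absNorm_rpow_neg {s : ℝ} (hs : 1 < s) :
    Summable fun I : Ideal (𝓞 K) => (absNorm I : ℝ) ^ (-s) := by
  have h : LSeriesSummable
      (fun n => ((Nat.card {I : Ideal (𝓞 K) // absNorm I = n} : ℝ) : ℂ)) (s : ℂ) :=
    LSeriesSummable_of_sum_norm_bigO_and_nonneg (sum_card_absNorm_eq_isBigO K)
      (fun _ => Nat.cast_nonneg _) zero_le_one (by simpa using hs)
  rw [← (Equiv.sigmaFiberEquiv (absNorm : Ideal (𝓞 K) → ℕ)).summable_iff,
    summable_sigma_of_nonneg (fun _ => by simp only [Function.comp_apply]; positivity)]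
  have hfin : ∀ n : ℕ, Finite {I : Ideal (𝓞 K) // absNorm I = n} := fun n =>
    finite_setOfPred_absNorm_eq n
  refine ⟨fun n => Summable.of_finite, ?_⟩
  refine (h.norm).congr fun n => ?_
  have : ∀ I : {I : Ideal (𝓞 K) // absNorm I = n},
      ((fun I : Ideal (𝓞 K) => (absNorm I : ℝ) ^ (-s)) ∘
        (Equiv.sigmaFiberEquiv (absNorm : Ideal (𝓞 K) → ℕ))) ⟨n, I⟩ = (n : ℝ) ^ (-s) := by
    rintro ⟨I, hI⟩
    simp [Equiv.sigmaFiberEquiv, hI]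
  rw [tsum_congr this, tsum_const, nsmul_eq_mul]
  rcases Nat.eq_zero_or_pos n with rfl | hn
  · simp [Real.zero_rpow (show -s ≠ 0 by linarith)]
  · rw [LSeries.norm_term_eq, if_neg hn.ne']
    simp [Real.rpow_neg, div_eq_mul_inv]

lemma summable_absNorm_sq_inv :
    Summable fun I : Ideal (𝓞 K) => ((absNorm I : ℝ) ^ 2)⁻¹ := by
  refine (summable_absNorm_rpow_neg K (s := 2) (by norm_num)).congr fun I => ?_
  rw [Real.rpow_neg (Nat.cast_nonneg _), Real.rpow_ofNat]

lemma tsum_absNorm_sq_inv_eq_tsum_card :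
    ∑' I : Ideal (𝓞 K), ((absNorm I : ℝ) ^ 2)⁻¹
      = ∑' n : ℕ, (Nat.card {I : Ideal (𝓞 K) // absNorm I = n} : ℝ) * ((n : ℝ) ^ 2)⁻¹ := by
  have h1 := ((Equiv.sigmaFiberEquiv (absNorm : Ideal (𝓞 K) → ℕ)).hasSum_iff.2
    (summable_absNorm_sq_inv K).hasSum)
  have h2 : ∀ n : ℕ, HasSum (fun I : {I : Ideal (𝓞 K) // absNorm I = n} =>
      ((absNorm I.1 : ℝ) ^ 2)⁻¹)
      ((Nat.card {I : Ideal (𝓞 K) // absNorm I = n} : ℝ) * ((n : ℝ) ^ 2)⁻¹) := fun n => by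
    have : Finite {I : Ideal (𝓞 K) // absNorm I = n} := finite_setOfPred_absNorm_eq n
    have e : (fun I : {I : Ideal (𝓞 K) // absNorm I = n} => ((absNorm I.1 : ℝ) ^ 2)⁻¹)
        = fun _ => ((n : ℝ) ^ 2)⁻¹ := funext fun I => by rw [I.2]
    rw [e, ← nsmul_eq_mul, ← tsum_const]
    exact Summable.of_finite.hasSum
  exact (HasSum.sigma h1 h2).tsum_eq.symm

lemma tsum_absNorm_sq_inv :
    ((∑' I : Ideal (𝓞 K), ((absNorm I : ℝ) ^ 2)⁻¹ : ℝ) : ℂ) = dedekindZeta K 2 := by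
  rw [tsum_absNorm_sq_inv_eq_tsum_card, Complex.ofReal_tsum, dedekindZeta, LSeries]
  refine tsum_congr fun n => ?_
  rw [LSeries.term]
  split_ifs with hn
  · simp [hn]
  · simp only [Complex.ofReal_mul, Complex.ofReal_inv, Complex.ofReal_pow,
      Complex.ofReal_natCast, Complex.cpow_ofNat, div_eq_mul_inv]

end IdealSums

/-! ### Inclusion-exclusion over finite sets of primes -/

section InclusionExclusion

open IsDedekindDomain

variable {R : Type*} [CommRing R] [IsDedekindDomain R]

/-- The product of a finite set of nonzero prime ideals. -/
noncomputable def primeProd (S : Finset (HeightOneSpectrum R)) : Ideal R :=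
  ∏ p ∈ S, p.asIdeal

lemma primeProd_ne_bot (S : Finset (HeightOneSpectrum R)) : primeProd S ≠ ⊥ :=
  Finset.prod_ne_zero_iff.2 fun p _ => p.ne_bot

lemma primeProd_dvd_iff {S : Finset (HeightOneSpectrum R)} {G : Ideal R} :
    primeProd S ∣ G ↔ ∀ p ∈ S, p.asIdeal ∣ G := by
  refine ⟨fun h p hp => (Finset.dvd_prod_of_mem _ hp).trans h, fun h => ?_⟩
  refine Finset.prod_dvd_of_coprime (fun p _ q _ hpq => ?_) h
  have := p.isMaximal
  have := q.isMaximal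
  exact Ideal.isCoprime_of_isMaximal fun h => hpq (HeightOneSpectrum.ext h)

/-- Unique factorisation; it transfers summability over ideals to finite sets of primes. -/
lemma primeProd_injective :
    Function.Injective (primeProd : Finset (HeightOneSpectrum R) → Ideal R) := by
  have key : ∀ S T : Finset (HeightOneSpectrum R), primeProd S = primeProd T → S ⊆ T := by
    intro S T h p hp
    have h1 : p.asIdeal ∣ primeProd T := h ▸ Finset.dvd_prod_of_mem _ hp
    obtain ⟨q, hq, hpq⟩ := (p.prime.dvd_finsetProd_iff _).1 h1
    have := p.isMaximal
    have := q.isMaximal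
    have : q.asIdeal = p.asIdeal :=
      Ideal.IsMaximal.eq_of_le ‹_› p.isPrime.ne_top (Ideal.dvd_iff_le.1 hpq)
    rwa [← HeightOneSpectrum.ext this]
  exact fun S T h => (key S T h).antisymm (key T S h.symm)

-- Only subsets of the finite set of primes dividing `G` contribute, and the alternating sum over a
-- powerset vanishes unless that set is empty, i.e. unless no prime divides `G`.
open Classical in
lemma hasSum_primeProd_dvd {G : Ideal R} (hG : G ≠ ⊥) :
    HasSum (fun S : Finset (HeightOneSpectrum R) =>
      if primeProd S ∣ G then (-1 : ℝ) ^ S.card else 0) (if G = ⊤ then 1 else 0) := by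
  have hfin : {p : HeightOneSpectrum R | p.asIdeal ∣ G}.Finite := Ideal.finite_factors hG
  set T := hfin.toFinset with hT
  have hmem : ∀ S : Finset (HeightOneSpectrum R), primeProd S ∣ G ↔ S ∈ T.powerset := fun S => by
    rw [primeProd_dvd_iff, Finset.mem_powerset]
    exact forall₂_congr fun p _ => by rw [hT, Set.Finite.mem_toFinset]; rfl
  have hTG : T = ∅ ↔ G = ⊤ := by
    constructor
    · intro h
      by_contra hG'
      obtain ⟨M, hM, hGM⟩ := Ideal.exists_le_maximal G hG'
      have hM0 : M ≠ ⊥ := fun h => hG (le_bot_iff.1 (h ▸ hGM))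
      have : (⟨M, hM.isPrime, hM0⟩ : HeightOneSpectrum R) ∈ T := by
        rw [hT, Set.Finite.mem_toFinset]
        exact Ideal.dvd_iff_le.2 hGM
      simp [h] at this
    · rintro rfl
      refine Finset.eq_empty_of_forall_notMem fun p hp => p.isPrime.ne_top ?_
      rw [hT, Set.Finite.mem_toFinset] at hp
      exact top_le_iff.1 (Ideal.dvd_iff_le.1 hp)
  have hsum : ∑ S ∈ T.powerset, (if primeProd S ∣ G then (-1 : ℝ) ^ S.card else 0)
      = if G = ⊤ then 1 else 0 := by
    rw [Finset.sum_congr rfl fun S hS => if_pos ((hmem S).2 hS)]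
    have := Finset.sum_powerset_neg_one_pow_card (x := T)
    rw [show (if G = ⊤ then (1 : ℝ) else 0) = ((if T = ∅ then (1 : ℤ) else 0 : ℤ) : ℝ) by
      simp [hTG], ← this]
    push_cast
    rfl
  rw [← hsum]
  exact hasSum_sum_of_ne_finset_zero fun S hS => if_neg fun h => hS ((hmem S).1 h)

end InclusionExclusion

/-! ### The Möbius sum as the inverse of the zeta value -/

section MoebiusZeta

variable (K : Type*) [Field K] [NumberField K]

open Ideal IsDedekindDomain

lemma one_le_absNorm_primeProd (S : Finset (HeightOneSpectrum (𝓞 K))) :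
    1 ≤ (absNorm (primeProd S) : ℝ) := by
  have : absNorm (primeProd S) ≠ 0 := fun h =>
    primeProd_ne_bot S (Ideal.absNorm_eq_zero_iff.1 h)
  exact_mod_cast Nat.one_le_iff_ne_zero.2 this

open Classical in
lemma hasSum_dvd_absNorm_sq_inv (I : Ideal (𝓞 K)) (hI : I ≠ ⊥) :
    HasSum (fun G : Ideal (𝓞 K) => if I ∣ G then ((absNorm G : ℝ) ^ 2)⁻¹ else 0)
      (((absNorm I : ℝ) ^ 2)⁻¹ * ∑' J : Ideal (𝓞 K), ((absNorm J : ℝ) ^ 2)⁻¹) := by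
  have hinj : Function.Injective fun J : Ideal (𝓞 K) => I * J := mul_right_injective₀ hI
  rw [← hinj.hasSum_iff]
  · convert! (summable_absNorm_sq_inv K).hasSum.mul_left (((absNorm I : ℝ) ^ 2)⁻¹) using 1
    ext J
    simp [mul_pow, mul_comm]
  · intro G hG
    exact if_neg fun ⟨J, hJ⟩ => hG ⟨J, hJ.symm⟩

/-- Sum `(-1)^|S| N(G)⁻²` over pairs with `primeProd S ∣ G` in both orders. Fixing `S` and writing
`G` as a multiple of `primeProd S` gives the product; fixing `G`, inclusion-exclusion kills all but
`G = ⊤`. -/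
lemma tsum_neg_one_pow_card_div_mul_tsum :
    (∑' S : Finset (HeightOneSpectrum (𝓞 K)),
        (-1 : ℝ) ^ S.card / (absNorm (primeProd S) : ℝ) ^ 2) *
      ∑' J : Ideal (𝓞 K), ((absNorm J : ℝ) ^ 2)⁻¹ = 1 := by
  classical
  set Z := ∑' J : Ideal (𝓞 K), ((absNorm J : ℝ) ^ 2)⁻¹ with hZ
  let f : Finset (HeightOneSpectrum (𝓞 K)) → Ideal (𝓞 K) → ℝ := fun S G =>
    if primeProd S ∣ G then (-1 : ℝ) ^ S.card * ((absNorm G : ℝ) ^ 2)⁻¹ else 0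
  have hf1 : ∀ S, HasSum (f S) ((-1 : ℝ) ^ S.card * (((absNorm (primeProd S) : ℝ) ^ 2)⁻¹ * Z)) :=
    fun S => by
      convert! (hasSum_dvd_absNorm_sq_inv K _ (primeProd_ne_bot S)).mul_left ((-1 : ℝ) ^ S.card)
        using 1
      ext G
      simp only [f, mul_ite, mul_zero]
  have hf2 : ∀ G, HasSum (fun S => f S G) (if G = ⊤ then 1 else 0) := fun G => by
    -- Every `S` divides the zero ideal, but its weight is `0⁻¹ = 0`.
    rcases eq_or_ne G ⊥ with rfl | hG
    · simp only [f, absNorm_bot]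
      have : (⊥ : Ideal (𝓞 K)) ≠ ⊤ := bot_ne_top
      simp [this, hasSum_zero]
    · convert! (hasSum_primeProd_dvd hG).mul_right (((absNorm G : ℝ) ^ 2)⁻¹) using 1
      · ext S
        simp only [f, ite_mul, zero_mul]
      · split_ifs with h <;> simp [h]
  have hsum : Summable (Function.uncurry f) := by
    rw [← summable_norm_iff, summable_prod_of_nonneg fun _ => norm_nonneg _]
    have hn : ∀ S G, ‖f S G‖ = if primeProd S ∣ G then ((absNorm G : ℝ) ^ 2)⁻¹ else 0 := by
      intro S G
      simp only [f]
      split_ifs <;> simp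
    simp only [Function.uncurry_apply_pair, hn]
    refine ⟨fun S => (hasSum_dvd_absNorm_sq_inv K _ (primeProd_ne_bot S)).summable, ?_⟩
    simp only [(hasSum_dvd_absNorm_sq_inv K _ (primeProd_ne_bot _)).tsum_eq]
    exact ((summable_absNorm_sq_inv K).comp_injective primeProd_injective).mul_right _
  have h := hsum.tsum_comm
  simp only [(hf1 _).tsum_eq, (hf2 _).tsum_eq] at h
  rw [tsum_ite_eq] at h
  rw [← tsum_mul_right]
  refine Eq.trans ?_ h.symm
  exact tsum_congr fun S => by ring

end MoebiusZeta

/-! ### From counting elements to counting pairs -/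

/-- Counting pairs with bounded product of weights, for a weight whose counting function is
`κ t + O(√t)`. -/
lemma exists_abs_ncard_mul_le_sub_le (κ C : ℝ) :
    ∃ B : ℝ, ∀ {ι : Type*} (ν : ι → ℕ), (∀ x, 0 < ν x) →
      (∀ t : ℝ, {x | (ν x : ℝ) ≤ t}.Finite) →
      (∀ t : ℝ, 1 ≤ t → |({x | (ν x : ℝ) ≤ t}.ncard : ℝ) - κ * t| ≤ C * t ^ (1 / 2 : ℝ)) →
      ∀ Y : ℝ, 1 ≤ Y →
        |({p : ι × ι | (ν p.1 : ℝ) * ν p.2 ≤ Y}.ncard : ℝ) - κ ^ 2 * (Y * Real.log Y)|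
          ≤ B * Y := by
  classical
  obtain ⟨B, hB⟩ := exists_abs_hyperbola_sum_sub_le κ C
  refine ⟨B, fun {ι} ν hν hfin h Y hY => ?_⟩
  set c : ℕ → ℝ := fun k => ({x | ν x = k}.ncard : ℝ) with hc
  have hA : ∀ t : ℝ, 0 ≤ t →
      ∑ k ∈ Finset.Icc 0 ⌊t⌋₊, c k = ({x | (ν x : ℝ) ≤ t}.ncard : ℝ) := fun t ht => by
    rw [Set.ncard_eq_toFinset_card _ (hfin t), Finset.card_eq_sum_card_fiberwise (f := ν)
      (t := Finset.Icc 0 ⌊t⌋₊)]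
    · push_cast
      refine Finset.sum_congr rfl fun k hk => ?_
      have hk' : (k : ℝ) ≤ t := (Nat.le_floor_iff ht).1 (Finset.mem_Icc.1 hk).2
      rw [hc]
      simp only
      rw [← Set.ncard_coe_finset]
      congr 2
      ext x
      simp only [Set.mem_ofPred_eq, Finset.coe_filter, Set.Finite.mem_toFinset]
      exact ⟨fun hx => ⟨hx ▸ hk', hx⟩, fun hx => hx.2⟩
    · intro x hx
      simp only [Finset.mem_coe, Set.Finite.mem_toFinset, Set.mem_ofPred_eq] at hx
      simpa using (Nat.le_floor_iff ht).2 hx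
  have hc0 : c 0 = 0 := by
    have : {x | ν x = 0} = ∅ := Set.eq_empty_of_forall_notMem fun x hx => (hν x).ne' hx
    simp [hc, this]
  have hmain := hB c hc0 (fun k => Nat.cast_nonneg _)
    (fun t ht => by rw [hA t (by linarith)]; exact h t ht) Y hY
  have hY0 : 0 < Y := by linarith
  suffices hcard : ({p : ι × ι | (ν p.1 : ℝ) * ν p.2 ≤ Y}.ncard : ℝ)
      = ∑ k ∈ Finset.Icc 0 ⌊Y⌋₊, c k * ∑ l ∈ Finset.Icc 0 ⌊Y / k⌋₊, c l by
    rw [hcard]; exact hmain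
  set F := (hfin Y).toFinset with hF
  have hmemF : ∀ x, x ∈ F ↔ (ν x : ℝ) ≤ Y := fun x => by simp [hF]
  have hone : ∀ x, (1 : ℝ) ≤ ν x := fun x => by exact_mod_cast hν x
  have hset : {p : ι × ι | (ν p.1 : ℝ) * ν p.2 ≤ Y}
      = ↑((F.sigma fun x => (hfin (Y / ν x)).toFinset).map
          (Equiv.sigmaEquivProd ι ι).toEmbedding) := by
    ext ⟨x, y⟩
    have hx0 : (0 : ℝ) < ν x := by linarith [hone x]
    simp only [Set.mem_ofPred_eq, Finset.coe_map, Set.mem_image, Finset.mem_coe, Finset.mem_sigma,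
      Set.Finite.mem_toFinset, hmemF, Sigma.exists, Equiv.coe_toEmbedding,
      Equiv.sigmaEquivProd_apply, Prod.mk.injEq]
    constructor
    · intro hxy
      refine ⟨x, y, ⟨?_, ?_⟩, rfl, rfl⟩
      · nlinarith [hone y]
      · rw [le_div_iff₀ hx0]; linarith
    · rintro ⟨x', y', ⟨-, h2⟩, rfl, rfl⟩
      rw [le_div_iff₀ hx0] at h2; linarith
  rw [hset, Set.ncard_coe_finset, Finset.card_map, Finset.card_sigma]
  push_cast
  have e : ∀ x ∈ F, ((hfin (Y / ν x)).toFinset.card : ℝ)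
      = ∑ l ∈ Finset.Icc 0 ⌊Y / ν x⌋₊, c l := fun x _ => by
    rw [hA _ (by positivity), Set.ncard_eq_toFinset_card _ (hfin _)]
  rw [Finset.sum_congr rfl e, ← Finset.sum_fiberwise_of_maps_to' (g := ν)
    (t := Finset.Icc 0 ⌊Y⌋₊) (fun x hx => by
      simpa using (Nat.le_floor_iff hY0.le).2 ((hmemF x).1 hx))
    (fun k => ∑ l ∈ Finset.Icc 0 ⌊Y / k⌋₊, c l)]
  refine Finset.sum_congr rfl fun k hk => ?_
  have hk' : (k : ℝ) ≤ Y := (Nat.le_floor_iff hY0.le).1 (Finset.mem_Icc.1 hk).2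
  rw [Finset.sum_const, nsmul_eq_mul]
  congr 1
  rw [hc]
  simp only
  rw [← Set.ncard_coe_finset]
  congr 2
  ext x
  simp only [Set.mem_ofPred_eq, Finset.coe_filter, hmemF]
  exact ⟨fun hx => hx.2, fun hx => ⟨hx ▸ hk', hx⟩⟩

/-! ### Points of bounded norm in ideals of an imaginary quadratic field -/

section ImaginaryQuadratic

variable {K : Type*} [Field K] [NumberField K]

open Ideal

/-- The nonzero elements of an ideal `J` whose norm is at most `t` times the norm of `J`. -/
def idealPoints (J : Ideal (𝓞 K)) (t : ℝ) : Set (𝓞 K) :=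
  {x | x ∈ J ∧ x ≠ 0 ∧ (absNorm (span {x}) : ℝ) ≤ t * absNorm J}

/-- Both sides of the norm inequality scale by `N(a)`. Hence the count depends only on the ideal
class of `J`, the source of uniformity. -/
lemma image_mul_idealPoints {a : 𝓞 K} (ha : a ≠ 0) (J : Ideal (𝓞 K)) (t : ℝ) :
    (fun x => a * x) '' idealPoints J t = idealPoints (span {a} * J) t := by
  have hN : (0 : ℝ) < absNorm (span {a}) := by
    have : absNorm (span {a}) ≠ 0 := fun h => ha (by simpa using absNorm_eq_zero_iff.1 h)
    exact_mod_cast Nat.pos_of_ne_zero this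
  have hnorm : ∀ x : 𝓞 K, (absNorm (span {a * x}) : ℝ) ≤ t * absNorm (span {a} * J) ↔
      (absNorm (span {x}) : ℝ) ≤ t * absNorm J := fun x => by
    rw [← span_singleton_mul_span_singleton, map_mul, map_mul]
    push_cast
    rw [← mul_le_mul_iff_right₀ hN (b := (absNorm (span {x}) : ℝ))]
    ring_nf
  ext z
  simp only [Set.mem_image, idealPoints, Set.mem_ofPred_eq, mem_span_singleton_mul]
  constructor
  · rintro ⟨x, ⟨hx, hx0, hxt⟩, rfl⟩
    exact ⟨⟨x, hx, rfl⟩, mul_ne_zero ha hx0, (hnorm x).2 hxt⟩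
  · rintro ⟨⟨x, hx, rfl⟩, hz0, hzt⟩
    exact ⟨x, ⟨hx, right_ne_zero_of_mul hz0, (hnorm x).1 hzt⟩, rfl⟩

/-- Pairs of nonzero elements of `J` with product of norms at most `Y` times the square of the norm
of `J`. -/
def idealPointPairs (J : Ideal (𝓞 K)) (Y : ℝ) : Set (𝓞 K × 𝓞 K) :=
  {p | (p.1 ∈ J ∧ p.1 ≠ 0) ∧ (p.2 ∈ J ∧ p.2 ≠ 0) ∧
    (absNorm (span {p.1}) : ℝ) * absNorm (span {p.2}) ≤ Y * (absNorm J : ℝ) ^ 2}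

variable [IsTotallyComplex K]

lemma nrComplexPlaces_eq_one_of_finrank_eq_two (h2 : Module.finrank ℚ K = 2) :
    InfinitePlace.nrComplexPlaces K = 1 := by
  have := IsTotallyComplex.finrank (K := K)
  omega

lemma subsingleton_infinitePlace_of_finrank_eq_two (h2 : Module.finrank ℚ K = 2) :
    Subsingleton (InfinitePlace K) := by
  classical
  have h1 := InfinitePlace.card_eq_nrRealPlaces_add_nrComplexPlaces K
  rw [IsTotallyComplex.nrRealPlaces_eq_zero, nrComplexPlaces_eq_one_of_finrank_eq_two h2] at h1
  exact Fintype.card_le_one_iff_subsingleton.1 (by omega)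

/-- There is a single infinite place, complex and so of multiplicity `2`; the square makes norm
bounds into disc bounds. -/
lemma infinitePlace_sq_eq_absNorm (h2 : Module.finrank ℚ K = 2) (w : InfinitePlace K)
    (x : 𝓞 K) : w x ^ 2 = (absNorm (span {x}) : ℝ) := by
  classical
  have := subsingleton_infinitePlace_of_finrank_eq_two h2
  have h := InfinitePlace.prod_eq_abs_norm (x : K)
  rw [Fintype.prod_subsingleton _ w, InfinitePlace.mult,
    if_neg (InfinitePlace.not_isReal_iff_isComplex.2 (IsTotallyComplex.isComplex w))] at h
  rw [h, absNorm_span_singleton, ← Algebra.coe_norm_int, Nat.cast_natAbs]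
  push_cast
  rfl

lemma norm_sq_eq_absNorm (h2 : Module.finrank ℚ K = 2) (φ : K →+* ℂ) (x : 𝓞 K) :
    ‖φ x‖ ^ 2 = (absNorm (span {x}) : ℝ) := by
  rw [← infinitePlace_sq_eq_absNorm h2 (InfinitePlace.mk φ) x, InfinitePlace.apply]

open scoped Classical in
lemma norm_mixedEmbedding_sq (h2 : Module.finrank ℚ K = 2) (x : 𝓞 K) :
    ‖mixedEmbedding K x‖ ^ 2 = (absNorm (span {x}) : ℝ) := by
  classical
  have := subsingleton_infinitePlace_of_finrank_eq_two h2
  obtain ⟨w⟩ : Nonempty (InfinitePlace K) := inferInstance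
  rw [← infinitePlace_sq_eq_absNorm h2 w x, mixedEmbedding.norm_eq_sup'_normAtPlace,
    Finset.sup'_eq_of_forall (a := w x) _ _ fun w' _ => by
      rw [Subsingleton.elim w' w, mixedEmbedding.normAtPlace_apply]]

open MeasureTheory in
open scoped Classical in
lemma volume_real_ball_mixedSpace (h2 : Module.finrank ℚ K = 2) :
    (volume : Measure (mixedEmbedding.mixedSpace K)).real (Metric.ball 0 1) = Real.pi := by
  have e : Metric.ball (0 : mixedEmbedding.mixedSpace K) 1
      = mixedEmbedding.convexBodyLT K fun _ => 1 := by
    rw [show (0 : mixedEmbedding.mixedSpace K) = (0, 0) from rfl, ← ball_prod_same,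
      ball_pi _ one_pos, ball_pi _ one_pos]
    rfl
  rw [e, measureReal_def, mixedEmbedding.convexBodyLT_volume, mixedEmbedding.convexBodyLTFactor,
    IsTotallyComplex.nrRealPlaces_eq_zero, nrComplexPlaces_eq_one_of_finrank_eq_two h2]
  simp

/-- The points lie in a disc of radius `√(t N(J))`, of area `π t N(J)`, while the lattice of `J` has
covolume `N(J) √|D| / 2`; the quotient is the main term. -/
lemma exists_abs_ncard_idealPoints_sub_le (h2 : Module.finrank ℚ K = 2) {J : Ideal (𝓞 K)}
    (hJ : J ≠ ⊥) :
    ∃ C : ℝ, 0 ≤ C ∧ ∀ t : ℝ, 1 ≤ t → (idealPoints J t).Finite ∧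
      |((idealPoints J t).ncard : ℝ) - 2 * Real.pi / √|(discr K : ℝ)| * t|
        ≤ C * t ^ (1 / 2 : ℝ) := by
  classical
  set I : (FractionalIdeal (nonZeroDivisors (𝓞 K)) K)ˣ :=
    FractionalIdeal.mk0 K ⟨J, mem_nonZeroDivisors_of_ne_zero hJ⟩ with hI
  have hE : Module.finrank ℝ (mixedEmbedding.mixedSpace K) = 2 := by
    rw [mixedEmbedding.finrank, h2]
  obtain ⟨C, hC⟩ := ZLattice.exists_abs_ncard_inter_closedBall_sub_le hE
    (mixedEmbedding.idealLattice K I) MeasureTheory.volume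
  obtain ⟨D, -, hD⟩ := ZLattice.exists_measureReal_ball_le_ncard_mul_covolume_le
    (mixedEmbedding.idealLattice K I) MeasureTheory.volume
  have hN : (1 : ℝ) ≤ absNorm J := by
    exact_mod_cast Nat.one_le_iff_ne_zero.2 fun h => hJ (absNorm_eq_zero_iff.1 h)
  have hN0 : (0 : ℝ) < absNorm J := by linarith
  have hdisc : 0 < √|(discr K : ℝ)| :=
    Real.sqrt_pos.2 (abs_pos.2 (Int.cast_ne_zero.2 (discr_ne_zero K)))
  have hmemI : ∀ y : K, y ∈ (I : Set K) ↔ ∃ x ∈ J, (x : K) = y := fun y => by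
    simp only [hI, FractionalIdeal.coe_mk0, SetLike.mem_coe]
    exact FractionalIdeal.mem_coeIdeal _
  have hemb : Function.Injective fun x : 𝓞 K => mixedEmbedding K (x : K) :=
    (mixedEmbedding_injective K).comp RingOfIntegers.coe_injective
  have hset : ∀ t : ℝ, 1 ≤ t →
      ((mixedEmbedding.idealLattice K I : Set (mixedEmbedding.mixedSpace K)) ∩
        Metric.closedBall 0 (√(t * absNorm J)))
      = (fun x : 𝓞 K => mixedEmbedding K (x : K)) '' (insert 0 (idealPoints J t)) := by
    intro t ht
    have hnorm : ∀ x : 𝓞 K, ‖mixedEmbedding K (x : K)‖ ≤ √(t * absNorm J) ↔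
        (absNorm (span {x}) : ℝ) ≤ t * absNorm J := fun x => by
      rw [Real.le_sqrt (norm_nonneg _) (by positivity), norm_mixedEmbedding_sq h2]
    ext z
    rw [Set.mem_inter_iff, SetLike.mem_coe, mixedEmbedding.mem_idealLattice,
      mem_closedBall_zero_iff, Set.mem_image]
    constructor
    · rintro ⟨⟨y, hy, rfl⟩, hz⟩
      obtain ⟨x, hxJ, rfl⟩ := (hmemI y).1 hy
      refine ⟨x, ?_, rfl⟩
      rw [Set.mem_insert_iff, or_iff_not_imp_left]
      exact fun hx0 => ⟨hxJ, hx0, (hnorm x).1 hz⟩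
    · rintro ⟨x, hx, rfl⟩
      rcases hx with rfl | hx
      · exact ⟨⟨0, (hmemI 0).2 ⟨0, J.zero_mem, by simp⟩, by simp⟩, (hnorm 0).2 <| by
          simp only [span_singleton_zero, absNorm_bot, Nat.cast_zero]; positivity⟩
      · exact ⟨⟨x, (hmemI x).2 ⟨x, hx.1, rfl⟩, rfl⟩, (hnorm x).2 hx.2.2⟩
  have hfin : ∀ t : ℝ, 1 ≤ t → (idealPoints J t).Finite := fun t ht => by
    have h := (hD (√(t * absNorm J))).1
    rw [hset t ht, Set.finite_image_iff hemb.injOn] at h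
    exact h.subset (Set.subset_insert _ _)
  have hC0 : 0 ≤ C := by simpa using (abs_nonneg _).trans (hC 1 le_rfl)
  -- The `1` pays for the origin, a lattice point excluded from `idealPoints`.
  refine ⟨C * √(absNorm J) + 1, by positivity, fun t ht => ⟨hfin t ht, ?_⟩⟩
  have htN : 1 ≤ t * absNorm J := one_le_mul_of_one_le_of_one_le ht hN
  have h := hC (√(t * absNorm J)) (Real.one_le_sqrt.2 htN)
  rw [hset t ht, Set.ncard_image_of_injective _ hemb,
    Set.ncard_insert_of_notMem (fun h => h.2.1 rfl) (hfin t ht), volume_real_ball_mixedSpace h2,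
    mixedEmbedding.covolume_idealLattice, Real.sq_sqrt (by positivity),
    nrComplexPlaces_eq_one_of_finrank_eq_two h2, hI, FractionalIdeal.coe_mk0,
    FractionalIdeal.coeIdeal_absNorm] at h
  have e : Real.pi / ((((absNorm J : ℕ) : ℚ) : ℝ) * 2⁻¹ ^ 1 * √|(discr K : ℝ)|) * (t * absNorm J)
      = 2 * Real.pi / √|(discr K : ℝ)| * t := by
    push_cast
    field_simp
  rw [e, Real.sqrt_mul (by linarith)] at h
  rw [← Real.sqrt_eq_rpow]
  have hst : 1 ≤ √t := Real.one_le_sqrt.2 ht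
  push_cast at h
  rw [abs_le] at h ⊢
  constructor <;> nlinarith [h.1, h.2]

/-- The count of points of bounded norm in an ideal, with an error uniform in the ideal. -/
lemma exists_forall_abs_ncard_idealPoints_sub_le (h2 : Module.finrank ℚ K = 2) :
    ∃ C : ℝ, ∀ J : Ideal (𝓞 K), J ≠ ⊥ → ∀ t : ℝ, 1 ≤ t → (idealPoints J t).Finite ∧
      |((idealPoints J t).ncard : ℝ) - 2 * Real.pi / √|(discr K : ℝ)| * t|
        ≤ C * t ^ (1 / 2 : ℝ) := by
  have hex : ∀ c : ClassGroup (𝓞 K), ∃ C : ℝ, 0 ≤ C ∧ ∀ J : Ideal (𝓞 K), ∀ hJ : J ≠ ⊥,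
      ClassGroup.mk0 ⟨J, mem_nonZeroDivisors_of_ne_zero hJ⟩ = c →
      ∀ t : ℝ, 1 ≤ t → (idealPoints J t).Finite ∧
      |((idealPoints J t).ncard : ℝ) - 2 * Real.pi / √|(discr K : ℝ)| * t|
        ≤ C * t ^ (1 / 2 : ℝ) := by
    intro c
    obtain ⟨I, rfl⟩ := ClassGroup.mk0_surjective c
    have hI : (I : Ideal (𝓞 K)) ≠ ⊥ := nonZeroDivisors.ne_zero I.2
    obtain ⟨C, hC0, hC⟩ := exists_abs_ncard_idealPoints_sub_le h2 hI
    refine ⟨C, hC0, fun J hJ hJI t ht => ?_⟩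
    obtain ⟨x, y, hx, hy, hxy⟩ := ClassGroup.mk0_eq_mk0_iff.1 hJI
    have e : (fun z => x * z) '' idealPoints J t = (fun z => y * z) '' idealPoints (I : Ideal (𝓞 K)) t := by
      rw [image_mul_idealPoints hx, image_mul_idealPoints hy]
      exact congrArg (fun L => idealPoints L t) hxy
    obtain ⟨hfin, hcard⟩ := hC t ht
    have e2 : (idealPoints J t).ncard = (idealPoints (I : Ideal (𝓞 K)) t).ncard := by
      rw [← Set.ncard_image_of_injective _ (mul_right_injective₀ hx), e,
        Set.ncard_image_of_injective _ (mul_right_injective₀ hy)]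
    refine ⟨?_, e2 ▸ hcard⟩
    rw [← Set.finite_image_iff (mul_right_injective₀ hx).injOn, e]
    exact hfin.image _
  choose C hC0 hC using hex
  -- The class group is finite and the constants are nonnegative, so their sum dominates each of
  -- them.
  refine ⟨∑ c, C c, fun J hJ t ht => ?_⟩
  obtain ⟨h1, h2⟩ := hC _ J hJ rfl t ht
  refine ⟨h1, h2.trans ?_⟩
  gcongr
  exact Finset.single_le_sum (fun c _ => hC0 c) (Finset.mem_univ _)

lemma exists_forall_abs_ncard_idealPointPairs_sub_le (h2 : Module.finrank ℚ K = 2) :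
    ∃ B : ℝ, ∀ J : Ideal (𝓞 K), J ≠ ⊥ →
      (∀ Y, (idealPointPairs J Y).Finite) ∧
      (∀ Y < 1, (idealPointPairs J Y).ncard = 0) ∧ ∀ Y, 1 ≤ Y →
      |((idealPointPairs J Y).ncard : ℝ) - 4 * Real.pi ^ 2 / |(discr K : ℝ)| * (Y * Real.log Y)|
        ≤ B * Y := by
  obtain ⟨C, hC⟩ := exists_forall_abs_ncard_idealPoints_sub_le h2
  obtain ⟨B, hB⟩ := exists_abs_ncard_mul_le_sub_le (2 * Real.pi / √|(discr K : ℝ)|) C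
  refine ⟨B, fun J hJ => ?_⟩
  have hN : 0 < absNorm J := Nat.pos_of_ne_zero fun h => hJ (absNorm_eq_zero_iff.1 h)
  have hN' : (0 : ℝ) < absNorm J := by exact_mod_cast hN
  have hdvd : ∀ x ∈ J, absNorm J ∣ absNorm (span {x}) := fun x hx =>
    absNorm_dvd_absNorm_of_le (by rwa [span_singleton_le_iff_mem])
  have hpos : ∀ x : 𝓞 K, x ≠ 0 → 0 < absNorm (span {x}) := fun x hx =>
    Nat.pos_of_ne_zero fun h => hx (by simpa using absNorm_eq_zero_iff.1 h)
  -- `N(J)` divides the norm of each element of `J`, so this relative norm is a positive integer; in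
  -- particular no pair exists for `Y < 1`.
  let ν : {x : 𝓞 K // x ∈ J ∧ x ≠ 0} → ℕ := fun x => absNorm (span {x.1}) / absNorm J
  have hν : ∀ x : {x : 𝓞 K // x ∈ J ∧ x ≠ 0},
      (absNorm (span {x.1}) : ℝ) = ν x * absNorm J := fun x => by
    exact_mod_cast (Nat.div_mul_cancel (hdvd x.1 x.2.1)).symm
  have hν0 : ∀ x, 0 < ν x := fun x =>
    Nat.div_pos (Nat.le_of_dvd (hpos _ x.2.2) (hdvd _ x.2.1)) hN
  have hset : ∀ t : ℝ, Subtype.val '' {x | (ν x : ℝ) ≤ t} = idealPoints J t := fun t => by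
    ext x
    simp only [Set.mem_image, Set.mem_ofPred_eq, idealPoints]
    constructor
    · rintro ⟨x, hx, rfl⟩
      refine ⟨x.2.1, x.2.2, ?_⟩
      rw [hν]
      gcongr
    · rintro ⟨h1, h2, h3⟩
      refine ⟨⟨x, h1, h2⟩, ?_, rfl⟩
      have := hν ⟨x, h1, h2⟩
      simp only at this
      rw [this] at h3
      exact le_of_mul_le_mul_right h3 hN'
  have hpairs : ∀ Y : ℝ, Prod.map Subtype.val Subtype.val ''
      {p : {x : 𝓞 K // x ∈ J ∧ x ≠ 0} × {x : 𝓞 K // x ∈ J ∧ x ≠ 0} | (ν p.1 : ℝ) * ν p.2 ≤ Y}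
      = idealPointPairs J Y := fun Y => by
    have key : ∀ x y : {x : 𝓞 K // x ∈ J ∧ x ≠ 0},
        (absNorm (span {x.1}) : ℝ) * absNorm (span {y.1}) ≤ Y * (absNorm J : ℝ) ^ 2 ↔
          (ν x : ℝ) * ν y ≤ Y := fun x y => by
      rw [hν x, hν y, show (ν x * absNorm J * (ν y * absNorm J) : ℝ)
        = ν x * ν y * (absNorm J : ℝ) ^ 2 by ring]
      exact mul_le_mul_iff_left₀ (by positivity)
    ext ⟨x, y⟩
    simp only [Set.mem_image, Set.mem_ofPred_eq, idealPointPairs, Prod.exists, Prod.map_apply,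
      Prod.mk.injEq]
    constructor
    · rintro ⟨x, y, hxy, rfl, rfl⟩
      exact ⟨x.2, y.2, (key x y).2 hxy⟩
    · rintro ⟨hx, hy, hxy⟩
      exact ⟨⟨x, hx⟩, ⟨y, hy⟩, (key ⟨x, hx⟩ ⟨y, hy⟩).1 hxy, rfl, rfl⟩
  have hinj := (Subtype.val_injective (p := fun x : 𝓞 K => x ∈ J ∧ x ≠ 0))
  have hfin : ∀ t : ℝ, {x | (ν x : ℝ) ≤ t}.Finite := fun t => by
    have h1 := (hC J hJ (max t 1) (le_max_right _ _)).1
    rw [← hset, Set.finite_image_iff hinj.injOn] at h1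
    exact h1.subset fun x (hx : (ν x : ℝ) ≤ t) => hx.trans (le_max_left t 1)
  refine ⟨fun Y => ?_, fun Y hY => ?_, fun Y hY => ?_⟩
  · rw [← hpairs Y]
    refine (((hfin Y).prod (hfin Y)).subset fun p hp => ?_).image _
    have h1 : (1 : ℝ) ≤ ν p.1 := by exact_mod_cast hν0 p.1
    have h2 : (1 : ℝ) ≤ ν p.2 := by exact_mod_cast hν0 p.2
    have h3 : (ν p.1 : ℝ) * ν p.2 ≤ Y := hp
    exact ⟨by change (ν p.1 : ℝ) ≤ Y; nlinarith, by change (ν p.2 : ℝ) ≤ Y; nlinarith⟩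
  · rw [← hpairs Y, Set.ncard_image_of_injective _ (hinj.prodMap hinj)]
    have : {p : {x : 𝓞 K // x ∈ J ∧ x ≠ 0} × {x : 𝓞 K // x ∈ J ∧ x ≠ 0} |
        (ν p.1 : ℝ) * ν p.2 ≤ Y} = ∅ := by
      refine Set.eq_empty_of_forall_notMem fun p hp => ?_
      have h1 : (1 : ℝ) ≤ ν p.1 := by exact_mod_cast hν0 p.1
      have h2 : (1 : ℝ) ≤ ν p.2 := by exact_mod_cast hν0 p.2
      have h3 : (ν p.1 : ℝ) * ν p.2 ≤ Y := hp
      nlinarith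
    rw [this, Set.ncard_empty]
  · have h := hB ν hν0 hfin (fun t ht => by
      rw [← Set.ncard_image_of_injective _ hinj, hset]
      exact (hC J hJ t ht).2) Y hY
    rw [← Set.ncard_image_of_injective _ (hinj.prodMap hinj), hpairs, div_pow,
      Real.sq_sqrt (abs_nonneg _)] at h
    convert! h using 4
    ring

end ImaginaryQuadratic

/-! ### Coprime pairs of integers of `K` -/

section CoprimePairs

variable {K : Type*} [Field K] [NumberField K]

open Ideal IsDedekindDomain

/-- Coprime pairs of nonzero integers of `K` with product of norms at most `X`. -/
def coprimePairs (K : Type*) [Field K] [NumberField K] (X : ℝ) : Set (𝓞 K × 𝓞 K) :=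
  {p | p.1 ≠ 0 ∧ p.2 ≠ 0 ∧ IsCoprime p.1 p.2 ∧
    (absNorm (span {p.1}) : ℝ) * absNorm (span {p.2}) ≤ X}

lemma coprimePairs_eq (X : ℝ) :
    coprimePairs K X = {p ∈ idealPointPairs (⊤ : Ideal (𝓞 K)) X | span {p.1} ⊔ span {p.2} = ⊤} := by
  ext p
  simp only [coprimePairs, idealPointPairs, Set.mem_ofPred_eq, Submodule.mem_top, true_and,
    absNorm_top, Nat.cast_one, one_pow, mul_one, ← isCoprime_iff_sup_eq,
    isCoprime_span_singleton_iff]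
  tauto

/-- Inclusion-exclusion applied to the gcd ideal `(q) + (s)`, nonzero because `q ≠ 0`: `primeProd S`
divides it exactly when it contains both entries. Dividing `X` by the squared norm cancels the
normalisation in `idealPointPairs`. -/
lemma hasSum_ncard_coprimePairs {X : ℝ}
    (hfin : (idealPointPairs (⊤ : Ideal (𝓞 K)) X).Finite) :
    HasSum (fun S : Finset (HeightOneSpectrum (𝓞 K)) => (-1 : ℝ) ^ S.card *
        ((idealPointPairs (primeProd S) (X / (absNorm (primeProd S) : ℝ) ^ 2)).ncard : ℝ))
      ((coprimePairs K X).ncard : ℝ) := by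
  classical
  have h := hasSum_sum (s := hfin.toFinset)
    (f := fun p (S : Finset (HeightOneSpectrum (𝓞 K))) =>
      if primeProd S ∣ span {p.1} ⊔ span {p.2} then (-1 : ℝ) ^ S.card else 0)
    (a := fun p => if span {p.1} ⊔ span {p.2} = ⊤ then 1 else 0) (fun p hp => by
      refine hasSum_primeProd_dvd fun h => ?_
      have h1 := ((Set.Finite.mem_toFinset _).1 hp).1.2
      exact h1 (by simpa using (sup_eq_bot_iff.1 h).1))
  convert! h using 1
  · ext S
    rw [Finset.sum_ite, Finset.sum_const_zero, add_zero, Finset.sum_const, nsmul_eq_mul, mul_comm,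
      ← Set.ncard_coe_finset (Finset.filter _ hfin.toFinset)]
    congr 3
    have hN : (absNorm (primeProd S) : ℝ) ≠ 0 := by linarith [one_le_absNorm_primeProd K S]
    ext p
    simp only [Finset.coe_filter, Set.Finite.mem_toFinset, idealPointPairs, Set.mem_ofPred_eq,
      Submodule.mem_top, true_and, absNorm_top, Nat.cast_one, one_pow, mul_one, dvd_iff_le,
      sup_le_iff, span_singleton_le_iff_mem]
    rw [div_mul_cancel₀ _ (pow_ne_zero 2 hN)]
    tauto
  · rw [Finset.sum_ite, Finset.sum_const_zero, add_zero, Finset.sum_const, nsmul_eq_mul, mul_one,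
      ← Set.ncard_coe_finset, coprimePairs_eq]
    congr 2
    ext p
    simp

lemma finite_coprimePairs [IsTotallyComplex K] (h2 : Module.finrank ℚ K = 2) (X : ℝ) :
    (coprimePairs K X).Finite := by
  obtain ⟨B, hB⟩ := exists_forall_abs_ncard_idealPointPairs_sub_le h2
  rw [coprimePairs_eq]
  exact ((hB ⊤ top_ne_bot).1 X).subset fun p hp => hp.1

lemma exists_abs_ncard_coprimePairs_sub_le [IsTotallyComplex K] (h2 : Module.finrank ℚ K = 2) :
    ∃ D : ℝ, ∀ X, 1 ≤ X →
      |((coprimePairs K X).ncard : ℝ) - 4 * Real.pi ^ 2 / |(discr K : ℝ)| *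
        (∑' J : Ideal (𝓞 K), ((absNorm J : ℝ) ^ 2)⁻¹)⁻¹ * (X * Real.log X)| ≤ D * X := by
  obtain ⟨B, hB⟩ := exists_forall_abs_ncard_idealPointPairs_sub_le h2
  have h := exists_abs_sub_le_of_hasSum_dilations
    (n := fun S : Finset (HeightOneSpectrum (𝓞 K)) => (absNorm (primeProd S) : ℝ))
    (m := fun S => (-1 : ℝ) ^ S.card) (one_le_absNorm_primeProd K)
    (fun S => by simp)
    ((summable_absNorm_rpow_neg K (s := 3 / 2) (by norm_num)).comp_injective primeProd_injective)
    (F := fun S Y => ((idealPointPairs (primeProd S) Y).ncard : ℝ))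
    (a := 4 * Real.pi ^ 2 / |(discr K : ℝ)|) (B := B) (by positivity)
    (fun S Y hY => by
      rw [(hB _ (primeProd_ne_bot S)).2.1 Y hY, Nat.cast_zero])
    (fun S Y hY => (hB _ (primeProd_ne_bot S)).2.2 Y hY)
    (P := fun X => ((coprimePairs K X).ncard : ℝ))
    (fun X _ => hasSum_ncard_coprimePairs ((hB ⊤ top_ne_bot).1 X))
  rwa [eq_inv_of_mul_eq_one_left (tsum_neg_one_pow_card_div_mul_tsum K)] at h

end CoprimePairs

/-! ### Translation classes and their denominators -/

section FareyClasses

variable {K : Type*} [Field K]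

open Ideal

/-- With comaximal numerator and denominator, each denominator divides the other; unique
factorisation of elements plays no role. -/
lemma exists_unit_mul_of_div_eq_div {p q p' q' : 𝓞 K} (hq : q ≠ 0) (hq' : q' ≠ 0)
    (h : IsCoprime p q) (h' : IsCoprime p' q') (e : (p' : K) / q' = (p : K) / q) :
    ∃ u : (𝓞 K)ˣ, p' = u * p ∧ q' = u * q := by
  rw [div_eq_div_iff (by exact_mod_cast hq') (by exact_mod_cast hq)] at e
  have e' : p' * q = p * q' := RingOfIntegers.ext (by simpa using e)
  have h1 : q' ∣ q := h'.symm.dvd_of_dvd_mul_left ⟨p, by rw [e', mul_comm]⟩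
  have h2 : q ∣ q' := h.symm.dvd_of_dvd_mul_left ⟨p', by rw [← e', mul_comm]⟩
  obtain ⟨u, hu⟩ := associated_of_dvd_dvd h2 h1
  refine ⟨u, ?_, by rw [← hu, mul_comm]⟩
  refine mul_right_cancel₀ hq ?_
  rw [e', ← hu]
  ring

/-- The class of the Farey pair `{p / q, r / s}` with `p * s - q * r = 1`, for coprime `q`, `s`. -/
noncomputable def fareyClass (x : 𝓞 K × 𝓞 K) : Quotient (translationSetoid K) := by
  classical
  exact if h : ∃ y : 𝓞 K × 𝓞 K, y.1 * x.2 - x.1 * y.2 = 1 then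
    Quotient.mk _ s((h.choose.1 : K) / x.1, (h.choose.2 : K) / x.2)
  -- Junk value, irrelevant for coprime denominators.
  else Quotient.mk _ s(0, 0)

/-- Two solutions of the determinant equation differ by `t (q, s)`, which translates both fractions
by `t`; the choice in `fareyClass` is immaterial. -/
lemma fareyClass_eq {p q r s : 𝓞 K} (hq : q ≠ 0) (hs : s ≠ 0) (h : p * s - q * r = 1) :
    fareyClass (q, s) = Quotient.mk (translationSetoid K) s((p : K) / q, (r : K) / s) := by
  have hex : ∃ y : 𝓞 K × 𝓞 K, y.1 * (q, s).2 - (q, s).1 * y.2 = 1 := ⟨(p, r), h⟩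
  rw [fareyClass, dif_pos hex]
  set y := hex.choose with hy
  have hy1 : y.1 * s - q * y.2 = 1 := hex.choose_spec
  refine Quotient.sound ?_
  have hcop : IsCoprime q s := ⟨-r, p, by linear_combination h⟩
  have hd : q ∣ p - y.1 := hcop.dvd_of_dvd_mul_right ⟨r - y.2, by linear_combination h - hy1⟩
  obtain ⟨t, ht⟩ := hd
  have ht2 : r - y.2 = t * s := mul_left_cancel₀ hq (by linear_combination hy1 - h + s * ht)
  refine ⟨t, ?_⟩
  have hqK : (q : K) ≠ 0 := by exact_mod_cast hq
  have hsK : (s : K) ≠ 0 := by exact_mod_cast hs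
  have e1 : (p : K) = y.1 + q * t := by
    have : p = y.1 + q * t := by linear_combination ht
    rw [this]; simp
  have e2 : (r : K) = y.2 + t * s := by
    have : r = y.2 + t * s := by linear_combination ht2
    rw [this]; simp
  rw [Sym2.map_mk, e1, e2]
  congr 2
  · field_simp
  · field_simp

/-- The pairs of denominators giving the same class as `x`. -/
def fareyTwist (x : 𝓞 K × 𝓞 K) (g : (𝓞 K)ˣ × Bool) : 𝓞 K × 𝓞 K :=
  if g.2 then (g.1 * x.1, (g.1⁻¹ : (𝓞 K)ˣ) * x.2)
  else (g.1 * x.2, -((g.1⁻¹ : (𝓞 K)ˣ) * x.1))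

/-- The swapped and unswapped families are disjoint: because of the sign, a common member would
force `2 * x.2 = 0`. -/
lemma fareyTwist_injective [CharZero K] {x : 𝓞 K × 𝓞 K} (h1 : x.1 ≠ 0) (h2 : x.2 ≠ 0) :
    Function.Injective (fareyTwist x) := by
  have key : ∀ u v : (𝓞 K)ˣ, (u : 𝓞 K) * x.1 = v * x.2 →
      ((u⁻¹ : (𝓞 K)ˣ) : 𝓞 K) * x.2 = -(((v⁻¹ : (𝓞 K)ˣ) : 𝓞 K) * x.1) → False := by
    intro u v e1 e2
    have h3 : (u : 𝓞 K) * ((u⁻¹ : (𝓞 K)ˣ) : 𝓞 K) = 1 := u.mul_inv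
    have h4 : (v : 𝓞 K) * ((v⁻¹ : (𝓞 K)ˣ) : 𝓞 K) = 1 := v.mul_inv
    have h5 : (2 : 𝓞 K) * x.2 = 0 := by
      have e3 : x.2 = -(u * (((v⁻¹ : (𝓞 K)ˣ) : 𝓞 K)) * x.1) := by
        linear_combination u * e2 - x.2 * h3
      have e4 : x.2 = u * (((v⁻¹ : (𝓞 K)ˣ) : 𝓞 K)) * x.1 := by
        linear_combination -((v⁻¹ : (𝓞 K)ˣ) : 𝓞 K) * e1 - x.2 * h4
      linear_combination e3 + e4
    rcases mul_eq_zero.1 h5 with h | h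
    · exact two_ne_zero h
    · exact h2 h
  rintro ⟨u, b⟩ ⟨v, c⟩ h
  rcases b <;> rcases c <;> simp only [fareyTwist, Bool.false_eq_true, if_true, if_false,
    Prod.mk.injEq] at h
  · rw [Units.ext (mul_right_cancel₀ h2 h.1)]
  · exact (key v u h.1.symm h.2.symm).elim
  · exact (key u v h.1 h.2).elim
  · rw [Units.ext (mul_right_cancel₀ h1 h.1)]

/-- Describes the fibres of `fareyClass`. After a translation the unordered pairs agree, so the
fractions match up to units `u`, `v`, possibly swapped. Determinant `1` on both sides forces `u v =
1`, or `u v = -1` after a swap, since swapping negates the determinant. -/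
lemma exists_fareyTwist_eq_iff {x y : 𝓞 K × 𝓞 K} (hx1 : x.1 ≠ 0) (hx2 : x.2 ≠ 0)
    (hx : IsCoprime x.1 x.2) :
    (∃ g, fareyTwist x g = y) ↔
      y.1 ≠ 0 ∧ y.2 ≠ 0 ∧ IsCoprime y.1 y.2 ∧ fareyClass y = fareyClass x := by
  obtain ⟨q, s⟩ := x
  obtain ⟨q', s'⟩ := y
  simp only at hx1 hx2 hx ⊢
  obtain ⟨a, p, hap⟩ := hx
  have hdet : p * s - q * (-a) = 1 := by linear_combination hap
  generalize -a = r at hdet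
  have hqK : (q : K) ≠ 0 := by exact_mod_cast hx1
  have hsK : (s : K) ≠ 0 := by exact_mod_cast hx2
  constructor
  · rintro ⟨⟨u, b⟩, h⟩
    have hu : (u : 𝓞 K) * ((u⁻¹ : (𝓞 K)ˣ) : 𝓞 K) = 1 := u.mul_inv
    have hu0 : (u : 𝓞 K) ≠ 0 := u.ne_zero
    have hi0 : ((u⁻¹ : (𝓞 K)ˣ) : 𝓞 K) ≠ 0 := (u⁻¹).ne_zero
    have huK : ((u : 𝓞 K) : K) ≠ 0 := by exact_mod_cast hu0
    have hiK : (((u⁻¹ : (𝓞 K)ˣ) : 𝓞 K) : K) ≠ 0 := by exact_mod_cast hi0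
    cases b
    · simp only [fareyTwist, Bool.false_eq_true, if_false, Prod.mk.injEq] at h
      obtain ⟨rfl, rfl⟩ := h
      have hd : (u * r) * (-(((u⁻¹ : (𝓞 K)ˣ) : 𝓞 K) * q))
          - (u * s) * (-(((u⁻¹ : (𝓞 K)ˣ) : 𝓞 K) * p)) = 1 := by
        linear_combination (p * s - q * r) * hu + hdet
      have hq' : (u : 𝓞 K) * s ≠ 0 := mul_ne_zero hu0 hx2
      have hs' : -(((u⁻¹ : (𝓞 K)ˣ) : 𝓞 K) * q) ≠ 0 := neg_ne_zero.2 (mul_ne_zero hi0 hx1)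
      refine ⟨hq', hs', ⟨((u⁻¹ : (𝓞 K)ˣ) : 𝓞 K) * p, u * r, by linear_combination hd⟩, ?_⟩
      rw [fareyClass_eq hx1 hx2 hdet, fareyClass_eq hq' hs' hd, Sym2.eq_swap]
      simp only [map_mul, map_neg, neg_div_neg_eq]
      rw [mul_div_mul_left _ _ huK, mul_div_mul_left _ _ hiK]
    · simp only [fareyTwist, if_true, Prod.mk.injEq] at h
      obtain ⟨rfl, rfl⟩ := h
      have hd : (u * p) * (((u⁻¹ : (𝓞 K)ˣ) : 𝓞 K) * s)
          - (u * q) * (((u⁻¹ : (𝓞 K)ˣ) : 𝓞 K) * r) = 1 := by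
        linear_combination (p * s - q * r) * hu + hdet
      have hq' : (u : 𝓞 K) * q ≠ 0 := mul_ne_zero hu0 hx1
      have hs' : ((u⁻¹ : (𝓞 K)ˣ) : 𝓞 K) * s ≠ 0 := mul_ne_zero hi0 hx2
      refine ⟨hq', hs', ⟨-(((u⁻¹ : (𝓞 K)ˣ) : 𝓞 K) * r), u * p, by linear_combination hd⟩, ?_⟩
      rw [fareyClass_eq hx1 hx2 hdet, fareyClass_eq hq' hs' hd]
      simp only [map_mul]
      rw [mul_div_mul_left _ _ huK, mul_div_mul_left _ _ hiK]
  · rintro ⟨hq', hs', ⟨a', p', hap'⟩, hF⟩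
    have hdet' : p' * s' - q' * (-a') = 1 := by linear_combination hap'
    generalize -a' = r' at hdet'
    rw [fareyClass_eq hx1 hx2 hdet, fareyClass_eq hq' hs' hdet'] at hF
    obtain ⟨t, ht⟩ := Quotient.exact hF.symm
    have e1 : (p : K) / q + t = ((p + t * q : 𝓞 K) : K) / q := by
      simp only [map_add, map_mul]; field_simp
    have e2 : (r : K) / s + t = ((r + t * s : 𝓞 K) : K) / s := by
      simp only [map_add, map_mul]; field_simp
    have c1 : IsCoprime (p + t * q) q := ⟨s, -(r + t * s), by linear_combination hdet⟩
    have c2 : IsCoprime (r + t * s) s := ⟨-q, p + t * q, by linear_combination hdet⟩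
    have c1' : IsCoprime p' q' := ⟨s', -r', by linear_combination hdet'⟩
    have c2' : IsCoprime r' s' := ⟨-q', p', by linear_combination hdet'⟩
    rw [Sym2.map_mk, e1, e2, Sym2.eq_iff] at ht
    rcases ht with ⟨h1, h2⟩ | ⟨h1, h2⟩
    · obtain ⟨u, hu1, hu2⟩ := exists_unit_mul_of_div_eq_div hx1 hq' c1 c1' h1
      obtain ⟨v, hv1, hv2⟩ := exists_unit_mul_of_div_eq_div hx2 hs' c2 c2' h2
      subst hu1 hu2 hv1 hv2
      have huv : (u : 𝓞 K) * v = 1 := by linear_combination hdet' - u * v * hdet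
      have hv : u⁻¹ = v := inv_eq_of_mul_eq_one_right (Units.ext (by simpa using huv))
      exact ⟨(u, true), by simp [fareyTwist, hv]⟩
    · obtain ⟨u, hu1, hu2⟩ := exists_unit_mul_of_div_eq_div hx2 hq' c2 c1' h1
      obtain ⟨v, hv1, hv2⟩ := exists_unit_mul_of_div_eq_div hx1 hs' c1 c2' h2
      subst hu1 hu2 hv1 hv2
      have huv : (u : 𝓞 K) * (-v : (𝓞 K)ˣ) = 1 := by
        push_cast
        linear_combination hdet' + u * v * hdet
      have hv : u⁻¹ = -v := inv_eq_of_mul_eq_one_right (Units.ext (by simpa using huv))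
      exact ⟨(u, false), by simp [fareyTwist, hv]⟩

end FareyClasses

/-! ### The imaginary quadratic asymptotic -/

section Counting

variable {K : Type*} [Field K] [NumberField K]

open Ideal

lemma absNorm_fareyTwist (x : 𝓞 K × 𝓞 K) (g : (𝓞 K)ˣ × Bool) :
    absNorm (span {(fareyTwist x g).1}) * absNorm (span {(fareyTwist x g).2})
      = absNorm (span {x.1}) * absNorm (span {x.2}) := by
  obtain ⟨u, b⟩ := g
  cases b
  · simp only [fareyTwist, Bool.false_eq_true, if_false, span_singleton_neg,
      span_singleton_mul_left_unit u.isUnit, span_singleton_mul_left_unit (u⁻¹).isUnit]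
    rw [mul_comm]
  · simp only [fareyTwist, if_true,
      span_singleton_mul_left_unit u.isUnit, span_singleton_mul_left_unit (u⁻¹).isUnit]

/-- Twisting preserves the product of norms, so each fibre is a full copy of units times `Bool`. -/
lemma ncard_coprimePairs_eq {X : ℝ} (hfin : (coprimePairs K X).Finite) :
    (coprimePairs K X).ncard
      = 2 * Nat.card (𝓞 K)ˣ * (fareyClass '' coprimePairs K X).ncard := by
  classical
  have hfib : ∀ x ∈ coprimePairs K X,
      {y ∈ coprimePairs K X | fareyClass y = fareyClass x} = Set.range (fareyTwist x) := by
    intro x hx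
    ext y
    rw [Set.mem_range, exists_fareyTwist_eq_iff hx.1 hx.2.1 hx.2.2.1]
    constructor
    · rintro ⟨hy, hF⟩
      exact ⟨hy.1, hy.2.1, hy.2.2.1, hF⟩
    · intro h
      obtain ⟨g, rfl⟩ := (exists_fareyTwist_eq_iff hx.1 hx.2.1 hx.2.2.1).2 h
      refine ⟨⟨h.1, h.2.1, h.2.2.1, ?_⟩, h.2.2.2⟩
      have := absNorm_fareyTwist x g
      have hx' := hx.2.2.2
      rw [← Nat.cast_mul] at hx' ⊢
      rwa [this]
  have hcard : ∀ x ∈ coprimePairs K X,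
      {y ∈ coprimePairs K X | fareyClass y = fareyClass x}.ncard = 2 * Nat.card (𝓞 K)ˣ := by
    intro x hx
    rw [hfib x hx, ← Set.image_univ,
      Set.ncard_image_of_injective _ (fareyTwist_injective hx.1 hx.2.1), Set.ncard_univ,
      Nat.card_prod]
    simp [mul_comm]
  rw [Set.ncard_eq_toFinset_card _ hfin, Set.ncard_eq_toFinset_card _ (hfin.image _),
    Finset.card_eq_sum_card_fiberwise (f := fareyClass) (t := (hfin.image fareyClass).toFinset)]
  · rw [Finset.sum_const_nat, mul_comm]
    intro c hc
    obtain ⟨x, hx, rfl⟩ := (Set.Finite.mem_toFinset _).1 hc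
    rw [← hcard x hx, ← Set.ncard_coe_finset]
    congr 1
    ext y
    simp
  · intro x hx
    simp only [Finset.mem_coe, Set.Finite.mem_toFinset] at hx ⊢
    exact ⟨x, hx, rfl⟩

lemma norm_sub_eq_inv_of_det {φ : K →+* ℂ} {p q r s : 𝓞 K} (hq : q ≠ 0) (hs : s ≠ 0)
    (h : p * s - q * r = 1) :
    ‖φ ((r : K) / s) - φ ((p : K) / q)‖ = (‖φ q‖ * ‖φ s‖)⁻¹ := by
  have hqK : (q : K) ≠ 0 := by exact_mod_cast hq
  have hsK : (s : K) ≠ 0 := by exact_mod_cast hs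
  have hK : (p : K) * s - q * r = 1 := by
    have := congrArg (algebraMap (𝓞 K) K) h
    simpa using this
  have e : (r : K) / s - (p : K) / q = -((q : K) * s)⁻¹ := by
    field_simp
    linear_combination -hK
  rw [← map_sub, e, map_neg, norm_neg, map_inv₀, norm_inv, map_mul, norm_mul]

lemma longFareyClasses_eq_image [IsTotallyComplex K] (h2 : Module.finrank ℚ K = 2)
    (φ : K →+* ℂ) {ε : ℝ} (hε : 0 < ε) :
    longFareyClasses φ ε = fareyClass '' coprimePairs K (1 / ε ^ 2) := by
  have key : ∀ q s : 𝓞 K, q ≠ 0 → s ≠ 0 →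
      ((absNorm (span {q}) : ℝ) * absNorm (span {s}) ≤ 1 / ε ^ 2 ↔
        ε ≤ (‖φ q‖ * ‖φ s‖)⁻¹) := by
    intro q s hq hs
    have hq' : 0 < ‖φ q‖ := norm_pos_iff.2 ((map_ne_zero φ).2 (by exact_mod_cast hq))
    have hs' : 0 < ‖φ s‖ := norm_pos_iff.2 ((map_ne_zero φ).2 (by exact_mod_cast hs))
    rw [← norm_sq_eq_absNorm h2 φ, ← norm_sq_eq_absNorm h2 φ, ← mul_pow, ← one_div_pow,
      pow_le_pow_iff_left₀ (by positivity) (by positivity) two_ne_zero, one_div,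
      le_inv_comm₀ (by positivity) hε]
  ext c
  constructor
  · rintro ⟨z, ⟨⟨α, β, rfl, p, q, r, s, hq, hs, rfl, rfl, hu⟩, α', β', hz, hlen⟩, rfl⟩
    obtain ⟨u, hu⟩ := hu
    have hui : ((u⁻¹ : (𝓞 K)ˣ) : 𝓞 K) * u = 1 := u.inv_mul
    have hi0 : ((u⁻¹ : (𝓞 K)ˣ) : 𝓞 K) ≠ 0 := (u⁻¹).ne_zero
    have hiK : (((u⁻¹ : (𝓞 K)ˣ) : 𝓞 K) : K) ≠ 0 := by exact_mod_cast hi0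
    -- Dividing `p` and `q` by the unit determinant normalises it to `1` and leaves `p / q`
    -- unchanged.
    have hdet : (((u⁻¹ : (𝓞 K)ˣ) : 𝓞 K) * p) * s - (((u⁻¹ : (𝓞 K)ˣ) : 𝓞 K) * q) * r = 1 := by
      linear_combination hui - ((u⁻¹ : (𝓞 K)ˣ) : 𝓞 K) * hu
    have hq' : ((u⁻¹ : (𝓞 K)ˣ) : 𝓞 K) * q ≠ 0 := mul_ne_zero hi0 hq
    have e : (p : K) / q = ((((u⁻¹ : (𝓞 K)ˣ) : 𝓞 K) * p : 𝓞 K) : K)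
        / ((((u⁻¹ : (𝓞 K)ˣ) : 𝓞 K) * q : 𝓞 K) : K) := by
      simp only [map_mul]
      rw [mul_div_mul_left _ _ hiK]
    rw [e] at hz ⊢
    refine ⟨(((u⁻¹ : (𝓞 K)ˣ) : 𝓞 K) * q, s), ⟨hq', hs, ⟨-r, ((u⁻¹ : (𝓞 K)ˣ) : 𝓞 K) * p, by
      linear_combination hdet⟩, ?_⟩, fareyClass_eq hq' hs hdet⟩
    rw [key _ _ hq' hs, ← norm_sub_eq_inv_of_det hq' hs hdet]
    rcases Sym2.eq_iff.1 hz with ⟨h3, h4⟩ | ⟨h3, h4⟩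
    · rwa [h3, h4]
    · rwa [h3, h4, norm_sub_rev]
  · rintro ⟨⟨q, s⟩, ⟨hq, hs, ⟨a, p, hap⟩, hX⟩, rfl⟩
    simp only at hq hs hap hX
    have hdet : p * s - q * (-a) = 1 := by linear_combination hap
    rw [fareyClass_eq hq hs hdet]
    refine ⟨_, ⟨⟨_, _, rfl, p, q, -a, s, hq, hs, rfl, rfl, ?_⟩, _, _, rfl, ?_⟩, rfl⟩
    · rw [hdet]; exact isUnit_one
    · rw [norm_sub_eq_inv_of_det hq hs hdet]
      exact (key q s hq hs).1 hX

lemma abs_discr_eq_neg [IsTotallyComplex K] (h2 : Module.finrank ℚ K = 2) :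
    |(discr K : ℝ)| = -(discr K : ℝ) := by
  have h := sign_discr K
  rw [nrComplexPlaces_eq_one_of_finrank_eq_two h2, pow_one, Int.sign_eq_neg_one_iff_neg] at h
  exact abs_of_neg (by exact_mod_cast h)

theorem imaginaryQuadratic_longFareyClasses [IsTotallyComplex K] (h2 : Module.finrank ℚ K = 2)
    (φ : K →+* ℂ) :
    (∀ ε : ℝ, 0 < ε → (longFareyClasses φ ε).Finite) ∧
      (fun ε : ℝ => ((longFareyClasses φ ε).ncard : ℂ) -
          4 * (Real.pi : ℂ) ^ 2 /
              ((Nat.card (𝓞 K)ˣ : ℂ) * (discr K : ℂ) * dedekindZeta K 2) *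
            ((Real.log ε / ε ^ 2 : ℝ) : ℂ))
        =O[𝓝[>] (0 : ℝ)] (fun ε : ℝ => (ε ^ 2)⁻¹) := by
  have hfin := finite_coprimePairs (K := K) h2
  refine ⟨fun ε hε => ?_, ?_⟩
  · rw [longFareyClasses_eq_image h2 φ hε]
    exact (hfin _).image _
  obtain ⟨D, hD⟩ := exists_abs_ncard_coprimePairs_sub_le (K := K) h2
  -- If the cardinal were the default `0`, the fibre count would make `coprimePairs K 1` empty, yet
  -- it contains `(1, 1)`.
  have hU : (Nat.card (𝓞 K)ˣ : ℝ) ≠ 0 := by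
    intro h
    have h1 := ncard_coprimePairs_eq (hfin 1)
    rw [Nat.cast_eq_zero.1 h, mul_zero, zero_mul, Set.ncard_eq_zero (hfin 1)] at h1
    have : ((1, 1) : 𝓞 K × 𝓞 K) ∈ coprimePairs K 1 :=
      ⟨one_ne_zero, one_ne_zero, isCoprime_one_left, by simp⟩
    rw [h1] at this
    exact this
  set U : ℝ := (Nat.card (𝓞 K)ˣ : ℝ) with hUdef
  set Z : ℝ := ∑' J : Ideal (𝓞 K), ((absNorm J : ℝ) ^ 2)⁻¹ with hZ
  have hZ0 : Z ≠ 0 := right_ne_zero_of_mul_eq_one (tsum_neg_one_pow_card_div_mul_tsum K)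
  have hd0 : (discr K : ℝ) ≠ 0 := Int.cast_ne_zero.2 (discr_ne_zero K)
  refine IsBigO.of_bound (|D| / |2 * U|) ?_
  filter_upwards [Ioo_mem_nhdsGT one_pos] with ε hε
  have hε0 : 0 < ε := hε.1
  have hX : 1 ≤ 1 / ε ^ 2 := by
    rw [le_div_iff₀ (by positivity), one_mul]
    exact pow_le_one₀ hε0.le hε.2.le
  -- This `2` cancels the one in `2 |𝓞ˣ|`; the sign is absorbed by the negative discriminant.
  have hlog : Real.log (1 / ε ^ 2) = -2 * Real.log ε := by
    rw [one_div, Real.log_inv, Real.log_pow]; push_cast; ring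
  have h := hD _ hX
  rw [ncard_coprimePairs_eq (hfin _), ← longFareyClasses_eq_image h2 φ hε0, hlog,
    abs_discr_eq_neg h2] at h
  have e : ((longFareyClasses φ ε).ncard : ℂ) -
          4 * (Real.pi : ℂ) ^ 2 /
              ((Nat.card (𝓞 K)ˣ : ℂ) * (discr K : ℂ) * dedekindZeta K 2) *
            ((Real.log ε / ε ^ 2 : ℝ) : ℂ)
      = (((longFareyClasses φ ε).ncard - 4 * Real.pi ^ 2 / (U * discr K * Z)
          * (Real.log ε / ε ^ 2) : ℝ) : ℂ) := by
    rw [← tsum_absNorm_sq_inv, ← hZ, hUdef]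
    push_cast
    rfl
  rw [e, Complex.norm_real, Real.norm_eq_abs, Real.norm_eq_abs,
    abs_of_pos (a := (ε ^ 2)⁻¹) (by positivity)]
  push_cast at h
  rw [← hUdef] at h
  have e2 : ((longFareyClasses φ ε).ncard : ℝ) - 4 * Real.pi ^ 2 / (U * discr K * Z)
          * (Real.log ε / ε ^ 2)
      = (2 * U * (longFareyClasses φ ε).ncard - 4 * Real.pi ^ 2 / -(discr K : ℝ) * Z⁻¹ *
        (1 / ε ^ 2 * (-2 * Real.log ε))) / (2 * U) := by
    field_simp
  rw [e2, abs_div, div_mul_eq_mul_div |D|]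
  refine div_le_div_of_nonneg_right (h.trans ?_) (abs_nonneg _)
  rw [one_div]
  gcongr
  exact le_abs_self D

end Counting

/-! ### Coprime pairs of positive integers -/

section CoprimeNat

open ArithmeticFunction in
lemma hasSum_moebius_dvd (n : ℕ+) :
    HasSum (fun d : ℕ+ => if (d : ℕ) ∣ n then ((moebius d : ℤ) : ℝ) else 0)
      (if (n : ℕ) = 1 then 1 else 0) := by
  have h1 : ∑ d ∈ (n : ℕ).divisors, (if d ∣ (n : ℕ) then ((moebius d : ℤ) : ℝ) else 0)
      = if (n : ℕ) = 1 then 1 else 0 := by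
    rw [Finset.sum_congr rfl fun d hd => if_pos (Nat.dvd_of_mem_divisors hd), ← Int.cast_sum,
      ← coe_mul_zeta_apply, moebius_mul_coe_zeta, one_apply]
    split_ifs <;> simp
  have h2 : HasSum (fun d : ℕ => if d ∣ (n : ℕ) then ((moebius d : ℤ) : ℝ) else 0)
      (if (n : ℕ) = 1 then 1 else 0) := by
    rw [← h1]
    exact hasSum_sum_of_ne_finset_zero fun d hd => if_neg fun h =>
      hd (Nat.mem_divisors.2 ⟨h, n.ne_zero⟩)
  have h3 : ∀ d ∉ Set.range ((↑) : ℕ+ → ℕ),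
      (if d ∣ (n : ℕ) then ((moebius d : ℤ) : ℝ) else 0) = 0 := fun d hd => by
    have : d = 0 := by
      by_contra h
      exact hd ⟨⟨d, Nat.pos_of_ne_zero h⟩, rfl⟩
    simp [this]
  exact (PNat.coe_injective.hasSum_iff h3).2 h2

open ArithmeticFunction in
lemma tsum_moebius_div_sq :
    ∑' d : ℕ+, ((moebius d : ℤ) : ℝ) / (d : ℝ) ^ 2 = 6 / Real.pi ^ 2 := by
  have h := LSeries_zeta_mul_Lseries_moebius (s := 2) (by norm_num)
  rw [LSeries_zeta_eq_riemannZeta (by norm_num), riemannZeta_two] at h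
  have e : LSeries (fun n => ((moebius n : ℤ) : ℂ)) 2
      = ((∑' d : ℕ+, ((moebius d : ℤ) : ℝ) / (d : ℝ) ^ 2 : ℝ) : ℂ) := by
    rw [Complex.ofReal_tsum, LSeries]
    have h0 : Function.support (LSeries.term (fun n => ((moebius n : ℤ) : ℂ)) 2)
        ⊆ Set.range ((↑) : ℕ+ → ℕ) := fun d hd => by
      refine ⟨⟨d, Nat.pos_of_ne_zero fun h => hd (by simp [h])⟩, rfl⟩
    rw [← PNat.coe_injective.tsum_eq h0]
    refine tsum_congr fun d => ?_
    rw [LSeries.term_of_ne_zero d.ne_zero]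
    simp
  rw [e] at h
  have h' : Real.pi ^ 2 / 6 * ∑' d : ℕ+, ((moebius d : ℤ) : ℝ) / (d : ℝ) ^ 2 = 1 := by
    exact_mod_cast h
  have := Real.pi_ne_zero
  field_simp at h' ⊢
  linarith

lemma finite_pnat_le (t : ℝ) : {x : ℕ+ | ((x : ℕ) : ℝ) ≤ t}.Finite := by
  refine Set.Finite.of_finite_image (f := ((↑) : ℕ+ → ℕ))
    ((Set.finite_Iic ⌊t⌋₊).subset ?_) PNat.coe_injective.injOn
  rintro _ ⟨x, hx, rfl⟩
  exact Nat.le_floor hx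

lemma finite_pnat_mul_le (Y : ℝ) :
    {p : ℕ+ × ℕ+ | ((p.1 : ℕ) : ℝ) * (p.2 : ℕ) ≤ Y}.Finite := by
  refine ((finite_pnat_le Y).prod (finite_pnat_le Y)).subset fun p hp => ?_
  have h1 : (1 : ℝ) ≤ (p.1 : ℕ) := by exact_mod_cast p.1.pos
  have h2 : (1 : ℝ) ≤ (p.2 : ℕ) := by exact_mod_cast p.2.pos
  have h3 : ((p.1 : ℕ) : ℝ) * (p.2 : ℕ) ≤ Y := hp
  exact ⟨by change ((p.1 : ℕ) : ℝ) ≤ Y; nlinarith, by change ((p.2 : ℕ) : ℝ) ≤ Y; nlinarith⟩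

lemma ncard_pnat_le {t : ℝ} (ht : 0 ≤ t) : {x : ℕ+ | ((x : ℕ) : ℝ) ≤ t}.ncard = ⌊t⌋₊ := by
  rw [← Set.ncard_image_of_injective _ PNat.coe_injective]
  have : ((↑) : ℕ+ → ℕ) '' {x : ℕ+ | ((x : ℕ) : ℝ) ≤ t} = ↑(Finset.Ioc 0 ⌊t⌋₊) := by
    ext x
    simp only [Set.mem_image, Set.mem_ofPred_eq, Finset.coe_Ioc, Set.mem_Ioc]
    constructor
    · rintro ⟨x, hx, rfl⟩
      exact ⟨x.pos, Nat.le_floor hx⟩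
    · rintro ⟨h1, h2⟩
      exact ⟨⟨x, h1⟩, (Nat.le_floor_iff ht).1 h2, rfl⟩
  rw [this, Set.ncard_coe_finset, Nat.card_Ioc, Nat.sub_zero]

/-- Coprime pairs of positive integers with product at most `X`. -/
def coprimePNatPairs (X : ℝ) : Set (ℕ+ × ℕ+) :=
  {p | ((p.1 : ℕ) : ℝ) * (p.2 : ℕ) ≤ X ∧ (p.1 : ℕ).Coprime p.2}

/-- Multiplying both coordinates by `d` is a bijection onto the pairs whose gcd is divisible by `d`.
-/
lemma ncard_pnat_mul_le_div_sq (X : ℝ) (d : ℕ+) :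
    {p : ℕ+ × ℕ+ | ((p.1 : ℕ) : ℝ) * (p.2 : ℕ) ≤ X / ((d : ℕ) : ℝ) ^ 2}.ncard
      = {p : ℕ+ × ℕ+ | ((p.1 : ℕ) : ℝ) * (p.2 : ℕ) ≤ X ∧
          (d : ℕ) ∣ Nat.gcd (p.1 : ℕ) (p.2 : ℕ)}.ncard := by
  have hd : (0 : ℝ) < ((d : ℕ) : ℝ) ^ 2 := by
    have : (0 : ℝ) < ((d : ℕ) : ℝ) := by exact_mod_cast d.pos
    positivity
  have key : ∀ x y : ℕ+, ((x : ℕ) : ℝ) * (y : ℕ) ≤ X / ((d : ℕ) : ℝ) ^ 2 ↔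
      (((d * x : ℕ+) : ℕ) : ℝ) * ((d * y : ℕ+) : ℕ) ≤ X := fun x y => by
    rw [le_div_iff₀ hd, PNat.mul_coe, PNat.mul_coe, Nat.cast_mul, Nat.cast_mul]
    ring_nf
  have hinj : Function.Injective fun p : ℕ+ × ℕ+ => (d * p.1, d * p.2) := fun p p' h =>
    Prod.ext (mul_left_cancel (congrArg Prod.fst h)) (mul_left_cancel (congrArg Prod.snd h))
  rw [← Set.ncard_image_of_injective _ hinj]
  congr 1
  ext ⟨x, y⟩
  simp only [Set.mem_image, Set.mem_ofPred_eq, Prod.exists, Prod.mk.injEq, Nat.dvd_gcd_iff,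
    ← PNat.dvd_iff]
  constructor
  · rintro ⟨x, y, hxy, rfl, rfl⟩
    exact ⟨(key x y).1 hxy, dvd_mul_right _ _, dvd_mul_right _ _⟩
  · rintro ⟨hxy, ⟨x, rfl⟩, ⟨y, rfl⟩⟩
    exact ⟨x, y, (key x y).2 hxy, rfl, rfl⟩

open ArithmeticFunction in
lemma hasSum_ncard_coprimePNatPairs (X : ℝ) :
    HasSum (fun d : ℕ+ => ((moebius d : ℤ) : ℝ) *
        ({p : ℕ+ × ℕ+ | ((p.1 : ℕ) : ℝ) * (p.2 : ℕ) ≤ X / ((d : ℕ) : ℝ) ^ 2}.ncard : ℝ))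
      ((coprimePNatPairs X).ncard : ℝ) := by
  have hfin := finite_pnat_mul_le X
  have h := hasSum_sum (s := hfin.toFinset) fun p _ => hasSum_moebius_dvd (PNat.gcd p.1 p.2)
  have hfilter : ∀ (P : ℕ+ × ℕ+ → Prop) [DecidablePred P], ((hfin.toFinset.filter P).card : ℝ)
      = ({p : ℕ+ × ℕ+ | ((p.1 : ℕ) : ℝ) * (p.2 : ℕ) ≤ X ∧ P p}.ncard : ℝ) := fun P _ => by
    rw [← Set.ncard_coe_finset, Finset.coe_filter]
    simp only [Set.Finite.mem_toFinset, Set.mem_ofPred_eq]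
  simp only [ncard_pnat_mul_le_div_sq]
  have e1 : ∀ d : ℕ+, ((moebius d : ℤ) : ℝ) *
      ({p : ℕ+ × ℕ+ | ((p.1 : ℕ) : ℝ) * (p.2 : ℕ) ≤ X ∧
          (d : ℕ) ∣ Nat.gcd (p.1 : ℕ) (p.2 : ℕ)}.ncard : ℝ)
      = ∑ p ∈ hfin.toFinset,
        if (d : ℕ) ∣ (PNat.gcd p.1 p.2 : ℕ) then ((moebius d : ℤ) : ℝ) else 0 := fun d => by
    rw [← Finset.sum_filter, Finset.sum_const, nsmul_eq_mul, hfilter, mul_comm]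
    simp only [PNat.gcd_coe]
  have e2 : ((coprimePNatPairs X).ncard : ℝ)
      = ∑ p ∈ hfin.toFinset, if (PNat.gcd p.1 p.2 : ℕ) = 1 then 1 else 0 := by
    rw [← Finset.sum_filter, Finset.sum_const, nsmul_eq_mul, mul_one, hfilter]
    simp only [PNat.gcd_coe]
    rfl
  rw [funext e1, e2]
  exact h

lemma exists_abs_ncard_coprimePNatPairs_sub_le :
    ∃ D : ℝ, ∀ X, 1 ≤ X →
      |((coprimePNatPairs X).ncard : ℝ) - 6 / Real.pi ^ 2 * (X * Real.log X)| ≤ D * X := by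
  obtain ⟨B, hB⟩ := exists_abs_ncard_mul_le_sub_le 1 1
  have hs : Summable fun d : ℕ+ => ((d : ℕ) : ℝ) ^ (-(3 / 2) : ℝ) :=
    (Real.summable_nat_rpow.2 (by norm_num)).comp_injective PNat.coe_injective
  have h := exists_abs_sub_le_of_hasSum_dilations
    (n := fun d : ℕ+ => ((d : ℕ) : ℝ))
    (m := fun d => ((ArithmeticFunction.moebius d : ℤ) : ℝ))
    (fun d => by exact_mod_cast d.pos)
    (fun d => by exact_mod_cast ArithmeticFunction.abs_moebius_le_one) hs
    (F := fun _ Y => ({p : ℕ+ × ℕ+ | ((p.1 : ℕ) : ℝ) * (p.2 : ℕ) ≤ Y}.ncard : ℝ))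
    (a := 1) (B := B) zero_le_one
    (fun d Y hY => by
      have : {p : ℕ+ × ℕ+ | ((p.1 : ℕ) : ℝ) * (p.2 : ℕ) ≤ Y} = ∅ := by
        refine Set.eq_empty_of_forall_notMem fun p hp => ?_
        have h1 : (1 : ℝ) ≤ (p.1 : ℕ) := by exact_mod_cast p.1.pos
        have h2 : (1 : ℝ) ≤ (p.2 : ℕ) := by exact_mod_cast p.2.pos
        have h3 : ((p.1 : ℕ) : ℝ) * (p.2 : ℕ) ≤ Y := hp
        nlinarith
      rw [this, Set.ncard_empty, Nat.cast_zero])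
    (fun d Y hY => by
      -- Here `κ = C = 1`, because `t - ⌊t⌋ ≤ 1 ≤ √t`.
      have := hB (fun x : ℕ+ => (x : ℕ)) (fun x => x.pos) finite_pnat_le (fun t ht => by
        have ht0 : 0 ≤ t := by linarith
        rw [ncard_pnat_le ht0, one_mul, one_mul, abs_sub_comm,
          abs_of_nonneg (sub_nonneg.2 (Nat.floor_le ht0))]
        have h1 := Nat.lt_floor_add_one t
        have h2 : 1 ≤ t ^ (1 / 2 : ℝ) := Real.one_le_rpow ht (by norm_num)
        linarith) Y hY
      rwa [one_pow] at this)
    (P := fun X => ((coprimePNatPairs X).ncard : ℝ))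
    (fun X _ => hasSum_ncard_coprimePNatPairs X)
  rwa [tsum_moebius_div_sq, one_mul] at h

end CoprimeNat

/-! ### Rational Farey pairs in the unit interval -/

section RationalFarey

/-- A unit determinant makes any representation reduced, hence equal to the standard one up to
units, which change the determinant only by a unit. -/
lemma areFareyNeighbours_rat_iff (α β : ℚ) :
    AreFareyNeighbours ℚ α β ↔ IsUnit (α.num * β.den - α.den * β.num) := by
  have hcop : ∀ γ : ℚ, IsCoprime ((γ.num : ℤ) : 𝓞 ℚ) (((γ.den : ℤ)) : 𝓞 ℚ) := fun γ =>
    (Rat.isCoprime_num_den γ).intCast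
  have hden : ∀ γ : ℚ, (((γ.den : ℤ)) : 𝓞 ℚ) ≠ 0 := fun γ => by
    exact_mod_cast γ.den_nz
  have hdiv : ∀ γ : ℚ, γ = (((γ.num : ℤ) : 𝓞 ℚ) : ℚ) / (((γ.den : ℤ) : 𝓞 ℚ) : ℚ) := fun γ => by
    simp only [map_intCast, Int.cast_natCast]
    exact (Rat.num_div_den γ).symm
  have hunit : IsUnit (α.num * β.den - α.den * β.num) ↔ IsUnit
      (((α.num : ℤ) : 𝓞 ℚ) * ((β.den : ℤ) : 𝓞 ℚ) - ((α.den : ℤ) : 𝓞 ℚ) * ((β.num : ℤ) : 𝓞 ℚ)) := by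
    rw [← MulEquiv.isUnit_map Rat.ringOfIntegersEquiv]
    simp
  rw [hunit]
  constructor
  · rintro ⟨p, q, r, s, hq, hs, rfl, rfl, hu⟩
    obtain ⟨d, hd⟩ := hu
    have hdi : ((d⁻¹ : (𝓞 ℚ)ˣ) : 𝓞 ℚ) * d = 1 := d.inv_mul
    have c1 : IsCoprime p q :=
      ⟨(d⁻¹ : (𝓞 ℚ)ˣ) * s, -((d⁻¹ : (𝓞 ℚ)ˣ) * r), by linear_combination hdi - (d⁻¹ : (𝓞 ℚ)ˣ) * hd⟩
    have c2 : IsCoprime r s :=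
      ⟨-((d⁻¹ : (𝓞 ℚ)ˣ) * q), (d⁻¹ : (𝓞 ℚ)ˣ) * p, by linear_combination hdi - (d⁻¹ : (𝓞 ℚ)ˣ) * hd⟩
    obtain ⟨u, hu1, hu2⟩ := exists_unit_mul_of_div_eq_div hq (hden _) c1
      (hcop ((p : ℚ) / q)) (hdiv _).symm
    obtain ⟨v, hv1, hv2⟩ := exists_unit_mul_of_div_eq_div hs (hden _) c2
      (hcop ((r : ℚ) / s)) (hdiv _).symm
    rw [hu1, hu2, hv1, hv2]
    have e : (u : 𝓞 ℚ) * p * (v * s) - u * q * (v * r) = ((u * v * d : (𝓞 ℚ)ˣ) : 𝓞 ℚ) := by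
      push_cast
      linear_combination -(u : 𝓞 ℚ) * v * hd
    rw [e]
    exact Units.isUnit _
  · intro h
    exact ⟨_, _, _, _, hden α, hden β, hdiv α, hdiv β, h⟩

/-- Pairs `α < β` of Farey neighbours in `[0, 1]` with `β - α` at least
`1 / X`. -/
def orderedFareyPairs (X : ℝ) : Set (ℚ × ℚ) :=
  {x | 0 ≤ x.1 ∧ x.2 ≤ 1 ∧ x.2.num * x.1.den - x.1.num * x.2.den = 1 ∧
    ((x.1.den : ℕ) : ℝ) * (x.2.den : ℕ) ≤ X}

lemma rat_sub_eq_inv_of_det {α β : ℚ} (h : β.num * α.den - α.num * β.den = 1) :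
    β - α = ((α.den : ℚ) * β.den)⁻¹ := by
  have h1 : (α.den : ℚ) ≠ 0 := by exact_mod_cast α.den_nz
  have h2 : (β.den : ℚ) ≠ 0 := by exact_mod_cast β.den_nz
  have h3 : (β.num : ℚ) * α.den - α.num * β.den = 1 := by exact_mod_cast h
  conv_lhs => rw [← Rat.num_div_den α, ← Rat.num_div_den β]
  field_simp
  linear_combination h3

lemma lt_of_rat_det {α β : ℚ} (h : β.num * α.den - α.num * β.den = 1) : α < β := by
  have h1 : (0 : ℚ) < α.den := by exact_mod_cast α.den_pos
  have h2 : (0 : ℚ) < β.den := by exact_mod_cast β.den_pos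
  rw [← sub_pos, rat_sub_eq_inv_of_det h]
  positivity

lemma le_abs_sub_iff_of_rat_det {α β : ℚ} (h : β.num * α.den - α.num * β.den = 1) {ε : ℝ}
    (hε : 0 < ε) : ε ≤ |(β : ℝ) - α| ↔ ((α.den : ℕ) : ℝ) * (β.den : ℕ) ≤ 1 / ε := by
  have h1 : (0 : ℝ) < α.den := by exact_mod_cast α.den_pos
  have h2 : (0 : ℝ) < β.den := by exact_mod_cast β.den_pos
  have e : (β : ℝ) - α = ((α.den : ℝ) * β.den)⁻¹ := by
    have := congrArg (fun x : ℚ => (x : ℝ)) (rat_sub_eq_inv_of_det h)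
    push_cast at this
    exact this
  rw [e, abs_of_pos (by positivity), le_inv_comm₀ hε (by positivity), one_div]

lemma rationalFareyPairs_eq_image {ε : ℝ} (hε : 0 < ε) :
    rationalFareyPairs ε = (fun x : ℚ × ℚ => s(x.1, x.2)) '' orderedFareyPairs (1 / ε) := by
  ext z
  constructor
  · rintro ⟨⟨α, β, rfl, hN⟩, α', β', hz, hα, hβ, hlen⟩
    rw [areFareyNeighbours_rat_iff, Int.isUnit_iff] at hN
    have hmem : α ∈ Set.Icc (0 : ℚ) 1 ∧ β ∈ Set.Icc (0 : ℚ) 1 ∧ ε ≤ |(β : ℝ) - α| := by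
      rcases Sym2.eq_iff.1 hz with ⟨rfl, rfl⟩ | ⟨rfl, rfl⟩
      · exact ⟨hα, hβ, hlen⟩
      · exact ⟨hβ, hα, by rwa [abs_sub_comm]⟩
    obtain ⟨h1, h2, h3⟩ := hmem
    rcases hN with hN | hN
    · have hd : α.num * β.den - β.num * α.den = 1 := by linarith
      exact ⟨(β, α), ⟨h2.1, h1.2, hd,
        (le_abs_sub_iff_of_rat_det hd hε).1 (by rwa [abs_sub_comm])⟩, Sym2.eq_swap⟩
    · have hd : β.num * α.den - α.num * β.den = 1 := by linarith
      exact ⟨(α, β), ⟨h1.1, h2.2, hd, (le_abs_sub_iff_of_rat_det hd hε).1 h3⟩, rfl⟩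
  · rintro ⟨⟨α, β⟩, ⟨h1, h2, h3, h4⟩, rfl⟩
    simp only at h1 h2 h3 h4
    have hlt := lt_of_rat_det h3
    refine ⟨⟨α, β, rfl, ?_⟩, α, β, rfl, ⟨h1, hlt.le.trans h2⟩, ⟨h1.trans hlt.le, h2⟩,
      (le_abs_sub_iff_of_rat_det h3 hε).2 h4⟩
    rw [areFareyNeighbours_rat_iff, Int.isUnit_iff]
    right; linarith

lemma injOn_mk_orderedFareyPairs (X : ℝ) :
    Set.InjOn (fun x : ℚ × ℚ => s(x.1, x.2)) (orderedFareyPairs X) := by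
  rintro ⟨α, β⟩ h ⟨α', β'⟩ h' e
  have h1 := lt_of_rat_det h.2.2.1
  have h2 := lt_of_rat_det h'.2.2.1
  simp only at h1 h2 e
  rcases Sym2.eq_iff.1 e with ⟨rfl, rfl⟩ | ⟨rfl, rfl⟩
  · rfl
  · exact (lt_asymm h1 h2).elim

/-- The pair of denominators of a pair of rational numbers. -/
def ratDens (x : ℚ × ℚ) : ℕ+ × ℕ+ := (⟨x.1.den, x.1.den_pos⟩, ⟨x.2.den, x.2.den_pos⟩)

lemma num_le_den_of_le_one {β : ℚ} (h : β ≤ 1) : β.num ≤ β.den := by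
  have h2 : (0 : ℚ) < β.den := by exact_mod_cast β.den_pos
  rw [← Rat.num_div_den β, div_le_one h2] at h
  exact_mod_cast h

/-- The determinant fixes the numerator of `β` modulo its denominator, and `0 < β ≤ 1` confines it
to `1, …, β.den`, one representative per residue. -/
lemma injOn_ratDens_orderedFareyPairs (X : ℝ) : Set.InjOn ratDens (orderedFareyPairs X) := by
  rintro ⟨α, β⟩ ⟨h1, h2, h3, -⟩ ⟨α', β'⟩ ⟨h1', h2', h3', -⟩ e
  have e1 : α.den = α'.den := congrArg (fun x : ℕ+ × ℕ+ => (x.1 : ℕ)) e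
  have e2 : β.den = β'.den := congrArg (fun x : ℕ+ × ℕ+ => (x.2 : ℕ)) e
  simp only at h1 h2 h3 h1' h2' h3'
  have hβ : 0 < β.num := Rat.num_pos.2 (h1.trans_lt (lt_of_rat_det h3))
  have hβ' : 0 < β'.num := Rat.num_pos.2 (h1'.trans_lt (lt_of_rat_det h3'))
  have hle := num_le_den_of_le_one h2
  have hle' := num_le_den_of_le_one h2'
  rw [← e1, ← e2] at h3'
  rw [← e2] at hle'
  have hcop : IsCoprime (β.den : ℤ) α.den := ⟨-α.num, β.num, by linear_combination h3⟩
  have hdvd : (β.den : ℤ) ∣ β.num - β'.num :=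
    hcop.dvd_of_dvd_mul_right ⟨α.num - α'.num, by linear_combination h3 - h3'⟩
  have hnum : β.num = β'.num := by
    have := Int.eq_zero_of_abs_lt_dvd hdvd (by rw [abs_lt]; constructor <;> linarith)
    linarith
  have hnum' : α.num = α'.num := by
    have hb : (β.den : ℤ) ≠ 0 := by exact_mod_cast β.den_nz
    refine mul_right_cancel₀ hb ?_
    rw [hnum] at h3
    linarith
  exact Prod.ext (Rat.ext hnum' e1) (Rat.ext hnum e2)

lemma image_ratDens_orderedFareyPairs (X : ℝ) :
    ratDens '' orderedFareyPairs X = coprimePNatPairs X := by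
  ext ⟨q, s⟩
  constructor
  · rintro ⟨⟨α, β⟩, ⟨h1, h2, h3, h4⟩, h⟩
    rw [← h]
    refine ⟨h4, Nat.isCoprime_iff_coprime.1 ⟨β.num, -α.num, ?_⟩⟩
    simp only [ratDens, PNat.mk_coe]
    simp only at h3
    linear_combination h3
  · rintro ⟨h4, hcop⟩
    simp only at h4 hcop
    have hq : (0 : ℤ) < (q : ℕ) := by exact_mod_cast q.pos
    have hs : (0 : ℤ) < (s : ℕ) := by exact_mod_cast s.pos
    obtain ⟨a, b, hab⟩ := Nat.isCoprime_iff_coprime.2 hcop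
    -- The representative of `a` modulo `s` in `1, …, s`, rather than `0, …, s - 1`: then `r / s ≤
    -- 1`, and `p s = r q - 1 ≥ 0` gives `p ≥ 0`.
    set r : ℤ := (s : ℕ) - (-a) % (s : ℕ) with hr
    have hr0 : 0 < r := sub_pos.2 (Int.emod_lt_of_pos _ hs)
    have hrs : r ≤ (s : ℕ) := by linarith [Int.emod_nonneg (-a) hs.ne']
    set k : ℤ := 1 + (-a) / (s : ℕ) with hk
    have hra : r = a + k * (s : ℕ) := by
      have := Int.emod_add_mul_ediv (-a) (s : ℕ)
      rw [hr, hk]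
      linear_combination -this
    set p : ℤ := k * (q : ℕ) - b with hp
    have hdet : r * (q : ℕ) - p * (s : ℕ) = 1 := by rw [hra, hp]; linear_combination hab
    have hp0 : 0 ≤ p := by
      have : 0 ≤ p * (s : ℕ) := by nlinarith
      exact nonneg_of_mul_nonneg_left this hs
    have c1 : p.natAbs.Coprime ((q : ℕ) : ℤ).natAbs :=
      Int.isCoprime_iff_gcd_eq_one.1 ⟨-(s : ℕ), r, by linear_combination hdet⟩
    have c2 : r.natAbs.Coprime ((s : ℕ) : ℤ).natAbs :=
      Int.isCoprime_iff_gcd_eq_one.1 ⟨(q : ℕ), -p, by linear_combination hdet⟩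
    have n1 := Rat.num_div_eq_of_coprime hq c1
    have d1 := Rat.den_div_eq_of_coprime hq c1
    have n2 := Rat.num_div_eq_of_coprime hs c2
    have d2 := Rat.den_div_eq_of_coprime hs c2
    have hqQ : (0 : ℚ) < (((q : ℕ) : ℤ) : ℚ) := by exact_mod_cast hq
    have hsQ : (0 : ℚ) < (((s : ℕ) : ℤ) : ℚ) := by exact_mod_cast hs
    have d1' : ((p : ℚ) / (((q : ℕ) : ℤ) : ℚ)).den = (q : ℕ) := by exact_mod_cast d1
    have d2' : ((r : ℚ) / (((s : ℕ) : ℤ) : ℚ)).den = (s : ℕ) := by exact_mod_cast d2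
    refine ⟨((p : ℚ) / (((q : ℕ) : ℤ) : ℚ), (r : ℚ) / (((s : ℕ) : ℤ) : ℚ)), ⟨?_, ?_, ?_, ?_⟩, ?_⟩
    · exact div_nonneg (by exact_mod_cast hp0) hqQ.le
    · exact (div_le_one hsQ).2 (by exact_mod_cast hrs)
    · simp only [n1, n2, d1, d2]
      exact hdet
    · simp only [d1', d2']
      exact h4
    · exact Prod.ext (PNat.eq d1') (PNat.eq d2')

theorem rationalFareyPairs_asymptotic :
    (∀ ε : ℝ, 0 < ε → (rationalFareyPairs ε).Finite) ∧
      (fun ε : ℝ => ((rationalFareyPairs ε).ncard : ℝ) -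
          -(6 / Real.pi ^ 2) * (Real.log ε / ε)) =O[𝓝[>] (0 : ℝ)] (fun ε : ℝ => ε⁻¹) := by
  have hcard : ∀ ε : ℝ, 0 < ε →
      (rationalFareyPairs ε).ncard = (coprimePNatPairs (1 / ε)).ncard := fun ε hε => by
    rw [rationalFareyPairs_eq_image hε, (injOn_mk_orderedFareyPairs _).ncard_image,
      ← image_ratDens_orderedFareyPairs, (injOn_ratDens_orderedFareyPairs _).ncard_image]
  refine ⟨fun ε hε => ?_, ?_⟩
  · rw [rationalFareyPairs_eq_image hε]
    refine Set.Finite.image _ ?_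
    rw [← Set.finite_image_iff (injOn_ratDens_orderedFareyPairs _),
      image_ratDens_orderedFareyPairs]
    exact (finite_pnat_mul_le _).subset fun p hp => hp.1
  obtain ⟨D, hD⟩ := exists_abs_ncard_coprimePNatPairs_sub_le
  refine IsBigO.of_bound D ?_
  filter_upwards [Ioo_mem_nhdsGT one_pos] with ε hε
  have hε0 : 0 < ε := hε.1
  have h := hD (1 / ε) ((one_le_div hε0).2 hε.2.le)
  rw [← hcard ε hε0, one_div, Real.log_inv] at h
  rw [Real.norm_eq_abs, Real.norm_eq_abs, abs_of_pos (a := ε⁻¹) (by positivity)]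
  convert! h using 2
  rw [div_eq_mul_inv (Real.log ε)]
  ring

end RationalFarey

theorem theorem1 :
    ((∀ ε : ℝ, 0 < ε → (rationalFareyPairs ε).Finite) ∧
      (fun ε : ℝ => ((rationalFareyPairs ε).ncard : ℝ) -
          -(6 / Real.pi ^ 2) * (Real.log ε / ε)) =O[𝓝[>] (0 : ℝ)] (fun ε : ℝ => ε⁻¹)) ∧
    (∀ (K : Type*) [Field K] [NumberField K] [IsTotallyComplex K],
      Module.finrank ℚ K = 2 → ∀ φ : K →+* ℂ,
        (∀ ε : ℝ, 0 < ε → (longFareyClasses φ ε).Finite) ∧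
        (fun ε : ℝ => ((longFareyClasses φ ε).ncard : ℂ) -
            4 * (Real.pi : ℂ) ^ 2 /
                ((Nat.card (𝓞 K)ˣ : ℂ) * (discr K : ℂ) * dedekindZeta K 2) *
              ((Real.log ε / ε ^ 2 : ℝ) : ℂ))
          =O[𝓝[>] (0 : ℝ)] (fun ε : ℝ => (ε ^ 2)⁻¹)) :=
  ⟨rationalFareyPairs_asymptotic, fun _ _ _ _ h2 φ => imaginaryQuadratic_longFareyClasses h2 φ⟩
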